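/- **Theorem (estimation of the upper bound in the average leave-some-out outcome model).** *Setting.* Let $Z=(X,A,Y)\sim P$ with $X\in\mathbb R^d$, $A\in\{0,1\}$, $Y\in\mathbb R$, $\mathbb E(Y^2)<\infty$. For $S\subseteq\{1,\dots,d\}$ let $X_{-S}$ be the covariates outside $S$ (so $X_{-\emptyset}=X$), $\pi_a(X_{-S})=\mathbb P(A=a\mid X_{-S})$, $\mu_a(X_{-S})=\mathbb E(Y\mid A=a,X_{-S})$, $\eta_a(X_{-S})=\mathbb E\{\mu_a(X)\mid A=1-a,X_{-S}\}$, and write $\|f(Z)\|_2=(\int f^2\,dP)^{1/2}$, where random (estimated) functions are held fixed in the integral. Let $\mathcal S$ be a finite set of subsets of $\{1,\dots,d\}$, $\Gamma\in(0,\infty)$, $\psi=\mathbb E\{\mu_1(X)-\mu_0(X)\}$, $$M_a=\sqrt{\tfrac1{|\mathcal S|}\sum_{S\in\mathcal S}\|\mu_a(X_{-S})-\eta_a(X_{-S})\|_2^2},\qquad \mathcal U(\Gamma)=\psi+\Gamma\sum_{a\in\{0,1\}}\|\pi_{1-a}(X)\|_2\,M_a .$$ The uncentered efficient influence functions of $\psi$,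 $\|\pi_a(X)\|_2^2$ and $\|\mu_a(X_{-S})-\eta_a(X_{-S})\|_2^2$ are $$\phi(Z)=\mu_1(X)-\mu_0(X)+\Big\{\tfrac{A}{\pi_1(X)}-\tfrac{1-A}{\pi_0(X)}\Big\}\{Y-\mu_A(X)\},$$ $$\xi_a(Z)=\pi_a(X)^2+2\pi_a(X)\{1(A=a)-\pi_a(X)\},$$ $$\begin{aligned}\lambda_a(Z;S)&=\{\mu_a(X_{-S})-\eta_a(X_{-S})\}^2+2\{\mu_a(X_{-S})-\eta_a(X_{-S})\}\Big[\tfrac{1(A=a)}{\pi_a(X_{-S})}\{Y-\mu_a(X_{-S})\}\\&\quad-\tfrac{1(A=a)}{\pi_a(X)}\{Y-\mu_a(X)\}\tfrac{\pi_{1-a}(X)}{\pi_{1-a}(X_{-S})}-\tfrac{1(A=1-a)}{\pi_{1-a}(X_{-S})}\{\mu_a(X)-\eta_a(X_{-S})\}\Big].\end{aligned}$$ *Estimator.* Let $Z_1,\dots,Z_n$ be i.i.d. from $P$, $\mathbb P_n$ their sample average, and let $\hat\pi_1(X_{-S})$, $\hat\mu_a(X_{-S})$, $\hat\eta_a(X_{-S})$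 be estimates constructed from a separate, independent i.i.d. sample of size $n$ from $P$, with $\hat\pi_0=1-\hat\pi_1$. Let $\hat\phi,\hat\xi_a,\hat\lambda_a$ be $\phi,\xi_a,\lambda_a$ with estimates in place of the true functions, and $$\hat{\mathcal U}(\Gamma)=\mathbb P_n\{\hat\phi(Z)\}+\Gamma\sum_{a\in\{0,1\}}\sqrt{\mathbb P_n\{\hat\xi_{1-a}(Z)\}}\sqrt{\tfrac1{|\mathcal S|}\sum_{S\in\mathcal S}\mathbb P_n\{\hat\lambda_a(Z;S)\}} .$$ *Assumptions.* There is $\varepsilon>0$ with $\varepsilon\le\pi_1(X)\le1-\varepsilon$ almost surely; for each $a\in\{0,1\}$, $\|\mu_a(X_{-S})-\eta_a(X_{-S})\|_2^2$ is finite for all $S\in\mathcal S$ and positive for some $S\in\mathcal S$. Moreover: 0. (regularity) for $a\in\{0,1\}$, $\hat\mu_a(X)$ is square-integrable, and for $S\in\mathcal S$, $\|\hat\mu_a(X_{-S})-\hat\eta_a(X_{-S})\|_\infty=O_{\mathbb P}(1)$ (essential supremum under $P$); 1. for $S\in\mathcal S\cup\{\emptyset\}$, $\hat\pi_1(X_{-S})$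 is bounded away from zero and one; 2. $\|\hat\phi(Z)-\phi(Z)\|_2\to0$ in probability; 3. for $a\in\{0,1\}$, $\|\hat\xi_a(Z)-\xi_a(Z)\|_2\to0$ in probability; 4. for $a\in\{0,1\}$, $S\in\mathcal S$, $\|\hat\lambda_a(Z;S)-\lambda_a(Z;S)\|_2\to0$ in probability; 5. for $a\in\{0,1\}$, $\|\hat\pi_1(X)-\pi_1(X)\|_2\,\|\hat\mu_a(X)-\mu_a(X)\|_2=o_{\mathbb P}(n^{-1/2})$; 6. $\|\hat\pi_1(X)-\pi_1(X)\|_2=o_{\mathbb P}(n^{-1/4})$; 7. for $a\in\{0,1\}$, $S\in\mathcal S$, the following sum is $o_{\mathbb P}(n^{-1/2})$: $$\begin{aligned}&\big(\|\hat\mu_a(X_{-S})-\mu_a(X_{-S})\|_2+\|\hat\eta_a(X_{-S})-\eta_a(X_{-S})\|_2\big)^2\\&+\|\hat\pi_{1-a}(X_{-S})-\pi_{1-a}(X_{-S})\|_2\,\|\hat\mu_a(X_{-S})-\mu_a(X_{-S})\|_2\\&+\|\hat\pi_{1-a}(X_{-S})-\pi_{1-a}(X_{-S})\|_2\,\big\|\mathbb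 E\{\hat\mu_a(X)\mid A=1-a,X_{-S}\}-\hat\eta_a(X_{-S})\big\|_2\\&+\|\hat\mu_a(X)-\mu_a(X)\|_2\big(\|\hat\pi_{1-a}(X)-\pi_{1-a}(X)\|_2+\|\hat\pi_{1-a}(X_{-S})-\pi_{1-a}(X_{-S})\|_2\big),\end{aligned}$$ where $\mathbb E\{\hat\mu_a(X)\mid\cdot\}$ is taken with $\hat\mu_a$ held fixed. *Conclusion.* Then $$\hat{\mathcal U}(\Gamma)-\mathcal U(\Gamma)=(\mathbb P_n-\mathbb E)\Big(\phi(Z)+\Gamma\sum_{a\in\{0,1\}}\Big[\|\pi_{1-a}(X)\|_2\Big\{\tfrac1{|\mathcal S|}\sum_{S\in\mathcal S}\tfrac{\lambda_a(Z;S)}{2M_a}\Big\}+M_a\Big\{\tfrac{\xi_{1-a}(Z)}{2\|\pi_{1-a}(X)\|_2}\Big\}\Big]\Big)+o_{\mathbb P}(n^{-1/2}).$$ -/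

import Mathlib

open MeasureTheory ProbabilityTheory Filter Topology
open scoped ENNReal NNReal

noncomputable section

namespace OutcomeModel

/-! ## Observations -/

/-- One observation `Z = (X, A, Y)`: covariates in `ℝ^d`, binary exposure, real outcome. -/
abbrev Obs (d : ℕ) : Type := (Fin d → ℝ) × Fin 2 × ℝ

/-- Values of the covariates that remain when those in `S` are left out. -/
abbrev CovOut {d : ℕ} (S : Finset (Fin d)) : Type := {j : Fin d // j ∉ S} → ℝ

variable {d : ℕ}

/-- The exposure `A`. -/
def expo (z : Obs d) : Fin 2 := z.2.1

/-- The outcome `Y`. -/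
def outc (z : Obs d) : ℝ := z.2.2

/-- `X_{-S}`, the covariates without those in `S`; `X_{-∅}` is all of `X`. -/
def covOut (S : Finset (Fin d)) (z : Obs d) : CovOut S := fun j => z.1 j

/-- The indicator `1(A = a)`. -/
def ind (a : Fin 2) (z : Obs d) : ℝ := if expo z = a then 1 else 0

/-- The σ-algebra on the observation space generated by `X_{-S}`. -/
@[reducible] def sigmaCov (S : Finset (Fin d)) : MeasurableSpace (Obs d) :=
  MeasurableSpace.comap (covOut S) inferInstance

/-- `E{f(Z) ∣ A = a, X_{-S}}`: the conditional expectation given `X_{-S}` in the subpopulation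
`A = a`, as a function of `X_{-S}`. -/
def condMean (P : Measure (Obs d)) (a : Fin 2) (S : Finset (Fin d)) (f : Obs d → ℝ) :
    Obs d → ℝ :=
  condExp (sigmaCov S) (ProbabilityTheory.cond P {z | expo z = a}) f

/-! ## Nuisance functions -/

/-- A choice of the nuisance functions, each read as a function of the observation:
`pi S a` for `π_a(X_{-S})`, `mu S a` for `μ_a(X_{-S})`, and `reg S a` for
`E{μ_a(X) ∣ A = 1 - a, X_{-S}}`. It is used for the true functions and for estimates of them. -/
structure Nuisances (d : ℕ) where
  pi : Finset (Fin d) → Fin 2 → Obs d → ℝ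
  mu : Finset (Fin d) → Fin 2 → Obs d → ℝ
  reg : Finset (Fin d) → Fin 2 → Obs d → ℝ

/-- The true nuisance functions under the distribution `P` of `Z`. -/
def trueNuis (P : Measure (Obs d)) : Nuisances d where
  pi S a := condExp (sigmaCov S) P (ind a)
  mu S a := condMean P a S outc
  reg S a := condMean P (1 - a) S (condMean P a ∅ outc)

/-- Estimators of the nuisance functions: for each `n`, (jointly measurable) maps from a training
sample of size `n` to functions of `X_{-S}`. `pi` estimates `π_1`, and `reg` is the (second stage)
regression estimator of `E{μ_a(X) ∣ A = 1 - a, X_{-S}}`. -/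
structure NuisEstimators (d : ℕ) where
  pi : (n : ℕ) → (S : Finset (Fin d)) → (Fin n → Obs d) → CovOut S → ℝ
  mu : (n : ℕ) → (S : Finset (Fin d)) → Fin 2 → (Fin n → Obs d) → CovOut S → ℝ
  reg : (n : ℕ) → (S : Finset (Fin d)) → Fin 2 → (Fin n → Obs d) → CovOut S → ℝ
  measurable_pi : ∀ n S, Measurable (Function.uncurry (pi n S))
  measurable_mu : ∀ n S a, Measurable (Function.uncurry (mu n S a))
  measurable_reg : ∀ n S a, Measurable (Function.uncurry (reg n S a))

/-- The estimated nuisance functions on the training sample `t`; the estimate of `π_0` is one minus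
that of `π_1`. -/
def NuisEstimators.fit (E : NuisEstimators d) (n : ℕ) (t : Fin n → Obs d) : Nuisances d where
  pi S a z := if a = 1 then E.pi n S t (covOut S z) else 1 - E.pi n S t (covOut S z)
  mu S a z := E.mu n S a t (covOut S z)
  reg S a z := E.reg n S a t (covOut S z)

/-- The contrast `μ_a(X_{-S}) - E{μ_a(X) ∣ A = 1 - a, X_{-S}}`. -/
def contrast (ν : Nuisances d) (a : Fin 2) (S : Finset (Fin d)) (z : Obs d) : ℝ :=
  ν.mu S a z - ν.reg S a z

/-! ## Uncentered efficient influence functions -/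

/-- `φ(Z)`, for the adjusted mean difference `ψ`. -/
def phi (ν : Nuisances d) (z : Obs d) : ℝ :=
  ν.mu ∅ 1 z - ν.mu ∅ 0 z +
    (ind 1 z / ν.pi ∅ 1 z - ind 0 z / ν.pi ∅ 0 z) * (outc z - ν.mu ∅ (expo z) z)

/-- `ξ_a`, for `‖π_a(X)‖_2^2`. -/
def xi (ν : Nuisances d) (a : Fin 2) (z : Obs d) : ℝ :=
  ν.pi ∅ a z ^ 2 + 2 * ν.pi ∅ a z * (ind a z - ν.pi ∅ a z)

/-- `λ_a(Z; S)`, for `‖μ_a(X_{-S}) - E{μ_a(X) ∣ A = 1 - a, X_{-S}}‖_2^2`. -/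
def lam (ν : Nuisances d) (a : Fin 2) (S : Finset (Fin d)) (z : Obs d) : ℝ :=
  contrast ν a S z ^ 2 +
    2 * contrast ν a S z *
      (ind a z / ν.pi S a z * (outc z - ν.mu S a z)
        - ind a z / ν.pi ∅ a z * (outc z - ν.mu ∅ a z) * (ν.pi ∅ (1 - a) z / ν.pi S (1 - a) z)
        - ind (1 - a) z / ν.pi S (1 - a) z * (ν.mu ∅ a z - ν.reg S a z))

/-! ## The estimand -/

/-- The `L_2(P)` norm of `f(Z)`, with values in `[0, ∞]`. -/
def norm2 (P : Measure (Obs d)) (f : Obs d → ℝ) : ℝ≥0∞ := eLpNorm f 2 P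

/-- `ψ = E{μ_1(X) - μ_0(X)}`. -/
def psi (P : Measure (Obs d)) : ℝ :=
  ∫ z, ((trueNuis P).mu ∅ 1 z - (trueNuis P).mu ∅ 0 z) ∂P

/-- `‖π_a(X)‖_2`. -/
def normPi (P : Measure (Obs d)) (a : Fin 2) : ℝ := (norm2 P ((trueNuis P).pi ∅ a)).toReal

/-- `M_a`, the square root of the average over `𝒮` of the measured confounding terms. -/
def measConf (P : Measure (Obs d)) (𝒮 : Finset (Finset (Fin d))) (a : Fin 2) : ℝ :=
  √((1 / (𝒮.card : ℝ)) * ∑ S ∈ 𝒮, (norm2 P (contrast (trueNuis P) a S)).toReal ^ 2)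

/-- The upper bound `𝒰(Γ)`. -/
def upperBound (P : Measure (Obs d)) (𝒮 : Finset (Finset (Fin d))) (Γ : ℝ) : ℝ :=
  psi P + Γ * ∑ a : Fin 2, normPi P (1 - a) * measConf P 𝒮 a

/-- Positivity of the propensity score. -/
def Positivity (P : Measure (Obs d)) : Prop :=
  ∃ ε : ℝ, 0 < ε ∧ ∀ᵐ z ∂P, ε ≤ (trueNuis P).pi ∅ 1 z ∧ (trueNuis P).pi ∅ 1 z ≤ 1 - ε

/-- Bounded and non-zero measured confounding. -/
def BoundedNonzeroConf (P : Measure (Obs d)) (𝒮 : Finset (Finset (Fin d))) : Prop :=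
  ∀ a : Fin 2, (∀ S ∈ 𝒮, norm2 P (contrast (trueNuis P) a S) ^ 2 < ∞) ∧
    ∃ S ∈ 𝒮, 0 < norm2 P (contrast (trueNuis P) a S) ^ 2

/-! ## The estimator -/

/-- Sample average `P_n{f(Z)}` over a sample of size `n`. -/
def sampleMean {n : ℕ} (s : Fin n → Obs d) (f : Obs d → ℝ) : ℝ := (1 / (n : ℝ)) * ∑ i, f (s i)

/-- The estimator of the upper bound from the estimation sample `s`, with the nuisance functions
estimated on the separate training sample `t`. -/
def upperEst (E : NuisEstimators d) (𝒮 : Finset (Finset (Fin d))) (Γ : ℝ) {n : ℕ}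
    (t s : Fin n → Obs d) : ℝ :=
  sampleMean s (phi (E.fit n t)) +
    Γ * ∑ a : Fin 2, √(sampleMean s (xi (E.fit n t) (1 - a))) *
      √((1 / (𝒮.card : ℝ)) * ∑ S ∈ 𝒮, sampleMean s (lam (E.fit n t) a S))

/-- The influence function of the estimator, uncentered. -/
def inflFun (P : Measure (Obs d)) (𝒮 : Finset (Finset (Fin d))) (Γ : ℝ) (z : Obs d) : ℝ :=
  phi (trueNuis P) z + Γ * ∑ a : Fin 2,
    (normPi P (1 - a) *
        ((1 / (𝒮.card : ℝ)) * ∑ S ∈ 𝒮, lam (trueNuis P) a S z / (2 * measConf P 𝒮 a))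
      + measConf P 𝒮 a * (xi (trueNuis P) (1 - a) z / (2 * normPi P (1 - a))))

/-! ## Stochastic order notation -/

variable {Ω : Type*} [MeasurableSpace Ω]

/-- `X_n = o_P(r_n)`, for `[0, ∞]`-valued `X_n` and rates `r_n ≥ 0`: for every `ε > 0`, the probability
of `X_n > ε r_n` tends to zero. -/
def IsLittleOP (Pr : Measure Ω) (X : ℕ → Ω → ℝ≥0∞) (r : ℕ → ℝ) : Prop :=
  ∀ ε : ℝ, 0 < ε → Tendsto (fun n => Pr {ω | ENNReal.ofReal (ε * r n) < X n ω}) atTop (𝓝 0)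

/-- `X_n = O_P(1)`, for `[0, ∞]`-valued `X_n`. -/
def IsBoundedP (Pr : Measure Ω) (X : ℕ → Ω → ℝ≥0∞) : Prop :=
  ∀ δ : ℝ≥0∞, 0 < δ → ∃ C : ℝ≥0, ∀ᶠ n in atTop, Pr {ω | (C : ℝ≥0∞) < X n ω} ≤ δ

/-- The first `n` terms of a sequence of random observations. -/
def firstN (Z : ℕ → Ω → Obs d) (n : ℕ) (ω : Ω) : Fin n → Obs d := fun i => Z i ω

/-- The sum of products of nuisance errors for `a` and `S`. In the third summand the conditional
mean of the estimate `μ̂_a(X)` is taken with the estimate held fixed. -/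
def errorProducts (P : Measure (Obs d)) (ν : Nuisances d) (a : Fin 2) (S : Finset (Fin d)) :
    ℝ≥0∞ :=
  (norm2 P (ν.mu S a - (trueNuis P).mu S a) + norm2 P (ν.reg S a - (trueNuis P).reg S a)) ^ 2
    + norm2 P (ν.pi S (1 - a) - (trueNuis P).pi S (1 - a)) *
        norm2 P (ν.mu S a - (trueNuis P).mu S a)
    + norm2 P (ν.pi S (1 - a) - (trueNuis P).pi S (1 - a)) *
        norm2 P (condMean P (1 - a) S (ν.mu ∅ a) - ν.reg S a)
    + norm2 P (ν.mu ∅ a - (trueNuis P).mu ∅ a) *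
        (norm2 P (ν.pi ∅ (1 - a) - (trueNuis P).pi ∅ (1 - a)) +
          norm2 P (ν.pi S (1 - a) - (trueNuis P).pi S (1 - a)))

end OutcomeModel

end

open OutcomeModel

/-! The bound is a smooth function of finitely many means: `ψ`, the squared norms of the propensity
scores, and the squared norms of the contrasts. Each is estimated by a sample mean of a plug-in
influence function fitted on independent data. For an influence function `f` with estimate `f̂`, the
error is `(P_n - E) f + (P_n - E)(f̂ - f) + (E f̂ - E f)`, expectations being taken with `f̂` fixed;
`isLittleOP_oneStep` shows that only the first term matters.

The middle term is negligible by sample splitting (`isLittleOP_empProc_split`): given the training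
sample it is a centered mean of a fixed function with small `L_2` norm, so Chebyshev's inequality
applies.

The last term is a bias of second order, by `phi_bias`, `xi_bias` and `lam_bias`. In each, `1(A =
a)` times a residual is replaced by its conditional mean, and what remains is a sum of products of
two nuisance errors, bounded by Cauchy–Schwarz. For `λ` the first-order effect of the error in
`μ̂_a(X)` inside the second-stage regression must cancel against the middle correction term. The
cancellation is exposed by adding a term of mean zero, obtained by conditioning the same weighted
error once on `X_{-S}` and once on `X`.

Applied to the true nuisances, the same bounds have right side zero, so the uncentered influence
functions have the intended means. Square integrability of `λ` is derived by first showing that the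
true contrast is bounded: it is an `L_2` limit of uniformly bounded estimates
(`exists_bound_contrast_true`).

Finally, the delta method for `√u √w` at a point with positive coordinates
(`isLittleOP_sqrt_mul_sqrt`) turns the expansions of the squared norms into that of the bound;
positivity of the coordinates comes from overlap and from non-zero measured confounding. -/

namespace OutcomeModel

variable {d : ℕ} {P : Measure (Obs d)} {ε C : ℝ} {S : Finset (Fin d)} {a : Fin 2}
  {f g u : Obs d → ℝ}

/-! ### Measurability of the basic objects -/

lemma measurable_expo : Measurable (expo : Obs d → Fin 2) := by
  unfold expo; fun_prop

lemma measurable_outc : Measurable (outc : Obs d → ℝ) := by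
  unfold outc; fun_prop

lemma measurable_covOut (S : Finset (Fin d)) : Measurable (covOut S) := by
  unfold covOut; fun_prop

lemma measurableSet_expo_eq (a : Fin 2) : MeasurableSet {z : Obs d | expo z = a} :=
  measurable_expo (measurableSet_singleton a)

lemma ind_eq_indicator (a : Fin 2) :
    (ind a : Obs d → ℝ) = Set.indicator {z | expo z = a} (fun _ => 1) := by
  ext z; simp [ind, Set.indicator]

lemma measurable_ind (a : Fin 2) : Measurable (ind a : Obs d → ℝ) := by
  rw [ind_eq_indicator]
  exact measurable_const.indicator (measurableSet_expo_eq a)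

lemma ind_nonneg (a : Fin 2) (z : Obs d) : 0 ≤ ind a z := by unfold ind; split_ifs <;> norm_num

lemma ind_le_one (a : Fin 2) (z : Obs d) : ind a z ≤ 1 := by unfold ind; split_ifs <;> norm_num

lemma abs_ind_le_one (a : Fin 2) (z : Obs d) : |ind a z| ≤ 1 := by
  rw [abs_of_nonneg (ind_nonneg a z)]; exact ind_le_one a z

lemma ind_sub (a : Fin 2) (z : Obs d) : ind (1 - a) z = 1 - ind a z := by
  unfold ind
  generalize expo z = b
  fin_cases a <;> fin_cases b <;> simp

lemma sigmaCov_le (S : Finset (Fin d)) : sigmaCov S ≤ (inferInstance : MeasurableSpace (Obs d)) :=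
  (measurable_covOut S).comap_le

lemma sigmaCov_le_empty (S : Finset (Fin d)) : sigmaCov S ≤ sigmaCov (∅ : Finset (Fin d)) := by
  have : covOut S = (fun x : CovOut (∅ : Finset (Fin d)) =>
      (fun j : {j // j ∉ S} => x ⟨j, by simp⟩)) ∘ covOut ∅ := rfl
  unfold sigmaCov
  rw [this, ← MeasurableSpace.comap_comp]
  refine MeasurableSpace.comap_mono ?_
  exact Measurable.comap_le (by fun_prop)

lemma stronglyMeasurable_comp_covOut {h : CovOut S → ℝ} (hh : Measurable h) :
    StronglyMeasurable[sigmaCov S] (fun z => h (covOut S z)) :=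
  (hh.comp (comap_measurable (covOut S))).stronglyMeasurable

lemma _root_.MeasureTheory.StronglyMeasurable.of_sigmaCov
    (hf : StronglyMeasurable[sigmaCov S] f) : StronglyMeasurable f :=
  hf.mono (sigmaCov_le S)

lemma stronglyMeasurable_pi (S : Finset (Fin d)) (a : Fin 2) :
    StronglyMeasurable[sigmaCov S] ((trueNuis P).pi S a) := stronglyMeasurable_condExp

lemma stronglyMeasurable_condMean (a : Fin 2) (S : Finset (Fin d)) (f : Obs d → ℝ) :
    StronglyMeasurable[sigmaCov S] (condMean P a S f) := stronglyMeasurable_condExp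

lemma pi_nonneg (S : Finset (Fin d)) (a : Fin 2) : ∀ᵐ z ∂P, 0 ≤ (trueNuis P).pi S a z :=
  condExp_nonneg (ae_of_all _ fun z => ind_nonneg a z)

/-- All propensity scores are bounded below by `ε`. -/
def Overlap (P : Measure (Obs d)) (ε : ℝ) : Prop :=
  0 < ε ∧ ∀ S a, ∀ᵐ z ∂P, ε ≤ (trueNuis P).pi S a z

lemma Overlap.mono {δ : ℝ} (h : Overlap P ε) (hδ : 0 < δ) (hle : δ ≤ ε) : Overlap P δ :=
  ⟨hδ, fun S a => (h.2 S a).mono fun _ hz => hle.trans hz⟩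

/-- The distribution of `Z` in the subpopulation `A = a`. -/
noncomputable abbrev condLaw (P : Measure (Obs d)) (a : Fin 2) : Measure (Obs d) :=
  ProbabilityTheory.cond P {z | expo z = a}

lemma integral_condLaw (f : Obs d → ℝ) :
    ∫ z, f z ∂(condLaw P a) = (P {z | expo z = a}).toReal⁻¹ * ∫ z, ind a z * f z ∂P := by
  have : ∀ z, ind a z * f z = Set.indicator {z | expo z = a} f z := by
    intro z; by_cases h : expo z = a <;> simp [ind, h]
  simp_rw [this, integral_indicator (measurableSet_expo_eq a)]
  simp [condLaw, ProbabilityTheory.cond, integral_smul_measure]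

lemma condLaw_le (a : Fin 2) :
    condLaw P a ≤ (P {z | expo z = a})⁻¹ • P :=
  Measure.le_iff.2 fun B hB => by
    simp only [condLaw, ProbabilityTheory.cond, Measure.smul_apply]
    gcongr; exact Measure.restrict_le_self

lemma _root_.MeasureTheory.MemLp.bdd_mul_left {p : ℝ≥0∞} (hf : MemLp f p P)
    (hg : AEStronglyMeasurable g P) (hb : ∀ᵐ z ∂P, |g z| ≤ C) :
    MemLp (fun z => g z * f z) p P :=
  hf.mul (memLp_top_of_bound hg C (by simpa using hb)) (p := ∞) (r := p)

section

variable [IsProbabilityMeasure P]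

lemma integrable_ind (a : Fin 2) : Integrable (ind a) P :=
  Integrable.of_bound (measurable_ind a).aestronglyMeasurable 1
    (ae_of_all _ fun z => by simpa using abs_ind_le_one a z)

/-! ### True propensity scores -/

lemma pi_sub (S : Finset (Fin d)) (a : Fin 2) :
    ∀ᵐ z ∂P, (trueNuis P).pi S (1 - a) z = 1 - (trueNuis P).pi S a z := by
  have h : (ind (1 - a) : Obs d → ℝ) = (fun _ => 1) - ind a := by ext z; simp [ind_sub]
  have := condExp_sub (integrable_const (1 : ℝ)) (integrable_ind (P := P) a) (sigmaCov S)
  rw [condExp_const (sigmaCov_le S)] at this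
  filter_upwards [this] with z hz
  simp only [trueNuis, h]
  rw [hz]; simp

lemma pi_le_one (S : Finset (Fin d)) (a : Fin 2) : ∀ᵐ z ∂P, (trueNuis P).pi S a z ≤ 1 := by
  filter_upwards [pi_sub (P := P) S a, pi_nonneg (P := P) S (1 - a)] with z h1 h2
  linarith

/-- By the tower property `π_a(X_{-S})` is the conditional expectation of `π_a(X)`, and conditional
expectation preserves a constant lower bound. The bound for `a = 0` is the upper bound for `π_1`. -/
lemma Positivity.overlap (h : Positivity P) : ∃ ε, Overlap P ε := by
  obtain ⟨ε, hε, h⟩ := h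
  have h0 : ∀ a, ∀ᵐ z ∂P, ε ≤ (trueNuis P).pi ∅ a z := by
    intro a
    filter_upwards [h, pi_sub (P := P) ∅ 1] with z hz hz1
    fin_cases a
    · simp only [sub_self] at hz1
      simp only [Fin.zero_eta, hz1]; linarith
    · exact hz.1
  refine ⟨ε, hε, fun S a => ?_⟩
  have h1 : P[(fun _ => ε) | sigmaCov S] ≤ᵐ[P] P[P[ind a | sigmaCov ∅] | sigmaCov S] :=
    condExp_mono (integrable_const _) integrable_condExp (h0 a)
  rw [condExp_const (sigmaCov_le S)] at h1
  filter_upwards [h1, condExp_condExp_of_le (f := ind a) (μ := P) (sigmaCov_le_empty S)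
    (sigmaCov_le ∅)] with z hz hz2
  simp only [trueNuis]
  rw [← hz2]; exact hz

/-! ### Pulling out conditional means -/

lemma integral_pi_mul (hg : StronglyMeasurable[sigmaCov S] g)
    (hgi : Integrable g P) :
    ∫ z, ind a z * g z ∂P = ∫ z, (trueNuis P).pi S a z * g z ∂P := by
  have hi : Integrable (g * ind a) P := by
    have := hgi.bdd_mul (measurable_ind a).aestronglyMeasurable (c := 1)
      (ae_of_all _ fun z => by simpa using abs_ind_le_one a z)
    exact this.congr (ae_of_all _ fun z => mul_comm _ _)
  have h := condExp_mul_of_stronglyMeasurable_left hg hi (integrable_ind a)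
  have h2 := integral_condExp (μ := P) (f := g * ind a) (sigmaCov_le S)
  rw [integral_congr_ae h] at h2
  simp only [Pi.mul_apply, mul_comm (g _)] at h2
  exact h2.symm

lemma measure_expo_pos (h : Overlap P ε) (a : Fin 2) : P {z | expo z = a} ≠ 0 := by
  intro h0
  have h1 : ∫ z, ind a z * 1 ∂P = 0 := by
    rw [← integral_zero (Obs d) ℝ (μ := P)]
    refine integral_congr_ae ?_
    have : ∀ᵐ z ∂P, ¬ expo z = a := by simpa [ae_iff] using h0
    filter_upwards [this] with z hz
    simp [ind, hz]
  rw [integral_pi_mul (S := ∅) (g := fun _ => 1) stronglyMeasurable_const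
    (integrable_const _)] at h1
  have h2 : ∫ _, ε ∂P ≤ ∫ z, (trueNuis P).pi ∅ a z * 1 ∂P := by
    refine integral_mono_ae (integrable_const _) ?_ ?_
    · simp only [mul_one]
      exact integrable_condExp
    · filter_upwards [h.2 ∅ a] with z hz
      simpa using hz
  simp at h2 h1
  linarith [h.1]

/-! ### Passing between `P` and the law in the subpopulation `A = a` -/

lemma _root_.MeasureTheory.MemLp.condLaw {p : ℝ≥0∞} (h : Overlap P ε) (hf : MemLp f p P)
    (a : Fin 2) : MemLp f p (condLaw P a) :=
  hf.of_measure_le_smul (c := (P {z | expo z = a})⁻¹)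
    (by simpa using measure_expo_pos h a) (condLaw_le a)

/-- For an event `B` in `σ(X_{-S})`, `P(A = a, B)` is the integral of `π_a(X_{-S})` over `B`, hence
at least `ε P(B)`; normalising by `P(A = a) ≤ 1` only helps. A conditional mean is determined only
under the law given `A = a`, and this domination makes it meaningful and integrable under `P`. -/
lemma trim_le (h : Overlap P ε) (S : Finset (Fin d)) (a : Fin 2) :
    P.trim (sigmaCov_le S) ≤ ENNReal.ofReal ε⁻¹ • (condLaw P a).trim (sigmaCov_le S) := by
  refine Measure.le_iff.2 fun B hB => ?_
  have hB' := sigmaCov_le S B hB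
  rw [Measure.smul_apply, trim_measurableSet_eq _ hB, trim_measurableSet_eq _ hB]
  have e1 : ε * P.real B ≤ P.real ({z | expo z = a} ∩ B) := by
    have h1 := integral_pi_mul (P := P) (S := S) (a := a)
      (g := Set.indicator B (fun _ => 1)) (stronglyMeasurable_const.indicator hB)
      ((integrable_const _).indicator hB')
    have h2 : ∫ z, ind a z * Set.indicator B (fun _ => (1 : ℝ)) z ∂P
        = P.real ({z | expo z = a} ∩ B) := by
      rw [← integral_indicator_one ((measurableSet_expo_eq a).inter hB')]
      refine integral_congr_ae (ae_of_all _ fun z => ?_)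
      by_cases hz : expo z = a <;> by_cases hz' : z ∈ B <;> simp [ind, hz, hz']
    have h3 : ε * P.real B = ∫ z, ε * Set.indicator B (fun _ => (1 : ℝ)) z ∂P := by
      rw [integral_const_mul]
      congr 1
      exact (integral_indicator_one hB').symm
    rw [← h2, h1, h3]
    refine integral_mono_ae (((integrable_const _).indicator hB').const_mul _) ?_ ?_
    · refine (((integrable_const (1 : ℝ)).indicator hB')).bdd_mul (c := 1)
        (stronglyMeasurable_pi S a).of_sigmaCov.aestronglyMeasurable ?_
      filter_upwards [pi_nonneg (P := P) S a, pi_le_one (P := P) S a] with z h1 h2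
      rw [Real.norm_of_nonneg h1]; exact h2
    · filter_upwards [h.2 S a] with z hz
      exact mul_le_mul_of_nonneg_right hz (Set.indicator_nonneg (by simp) _)
  have e2 : P B ≤ ENNReal.ofReal ε⁻¹ * P ({z | expo z = a} ∩ B) := by
    rw [← ofReal_measureReal (μ := P) (s := B), ← ofReal_measureReal (μ := P),
      ← ENNReal.ofReal_mul (by have := h.1; positivity)]
    refine ENNReal.ofReal_le_ofReal ?_
    rw [inv_mul_eq_div, le_div_iff₀ h.1]; linarith
  refine e2.trans ?_
  rw [smul_eq_mul]
  refine mul_le_mul_right ?_ _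
  rw [condLaw, cond_apply (measurableSet_expo_eq a)]
  calc _ = 1 * P ({z | expo z = a} ∩ B) := (one_mul _).symm
    _ ≤ _ := by
      gcongr
      exact ENNReal.one_le_inv.2 prob_le_one

lemma isProbabilityMeasure_condLaw (h : Overlap P ε) (a : Fin 2) :
    IsProbabilityMeasure (condLaw P a) :=
  cond_isProbabilityMeasure (measure_expo_pos h a)

lemma memLp_of_condLaw {p : ℝ≥0∞} (h : Overlap P ε)
    (hf : StronglyMeasurable[sigmaCov S] f) (hfp : MemLp f p (condLaw P a)) : MemLp f p P := by
  refine memLp_of_memLp_trim (sigmaCov_le S) ?_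
  have h1 : MemLp f p ((condLaw P a).trim (sigmaCov_le S)) := by
    refine ⟨hf.aestronglyMeasurable, ?_⟩
    rw [eLpNorm_trim (sigmaCov_le S) hf]; exact hfp.2
  exact h1.of_measure_le_smul ENNReal.ofReal_ne_top (trim_le h S a)

lemma memLp_condMean {p : ℝ≥0∞} (hp : 1 ≤ p) (h : Overlap P ε) (hf : MemLp f p P)
    (a : Fin 2) (S : Finset (Fin d)) : MemLp (condMean P a S f) p P :=
  memLp_of_condLaw h (stronglyMeasurable_condMean a S f) ((hf.condLaw h a).condExp hp)

/-- Conditional means given `A = a` and `X_{-S}` as inverse probability weighted means. -/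
lemma integral_ind_mul_condMean (h : Overlap P ε) (hf : MemLp f 1 P)
    (hg : StronglyMeasurable[sigmaCov S] g) (hgC : ∀ᵐ z ∂P, |g z| ≤ C) :
    ∫ z, ind a z * (g z * f z) ∂P
      = ∫ z, (trueNuis P).pi S a z * (g z * condMean P a S f z) ∂P := by
  have := isProbabilityMeasure_condLaw h a
  have hgf := hf.bdd_mul_left hg.of_sigmaCov.aestronglyMeasurable hgC
  have hgm := (memLp_condMean le_rfl h hf a S).bdd_mul_left
    hg.of_sigmaCov.aestronglyMeasurable hgC
  have h1 : (condLaw P a)[g * f | sigmaCov S] =ᵐ[condLaw P a] g * condMean P a S f :=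
    condExp_mul_of_stronglyMeasurable_left hg (memLp_one_iff_integrable.1 (hgf.condLaw h a))
      (memLp_one_iff_integrable.1 (hf.condLaw h a))
  have h2 := integral_condExp (μ := condLaw P a) (f := g * f) (sigmaCov_le S)
  rw [integral_congr_ae h1, integral_condLaw, integral_condLaw] at h2
  have h3 := mul_left_cancel₀ (inv_ne_zero (by
    simpa [ENNReal.toReal_eq_zero_iff] using measure_expo_pos h a)) h2
  simp only [Pi.mul_apply] at h3
  rw [← h3]
  exact integral_pi_mul (hg.mul (stronglyMeasurable_condMean a S f))
    (memLp_one_iff_integrable.1 hgm)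

/-- The regression residual `f - u` with inverse weights replaced by its conditional mean. -/
lemma integral_ind_mul_sub (h : Overlap P ε) (hf : MemLp f 1 P)
    (hu : MemLp u 1 P) (hum : StronglyMeasurable[sigmaCov S] u)
    (hg : StronglyMeasurable[sigmaCov S] g) (hgC : ∀ᵐ z ∂P, |g z| ≤ C) :
    ∫ z, ind a z * (g z * (f z - u z)) ∂P
      = ∫ z, (trueNuis P).pi S a z * (g z * (condMean P a S f z - u z)) ∂P := by
  have hgm := hg.of_sigmaCov.aestronglyMeasurable (μ := P)
  have hi : ∀ ⦃v : Obs d → ℝ⦄, MemLp v 1 P → Integrable (fun z => ind a z * (g z * v z)) P :=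
    fun v hv => memLp_one_iff_integrable.1 ((hv.bdd_mul_left hgm hgC).bdd_mul_left (C := 1)
      (measurable_ind a).aestronglyMeasurable (ae_of_all _ (abs_ind_le_one a)))
  have hp : ∀ ⦃v : Obs d → ℝ⦄, MemLp v 1 P →
      Integrable (fun z => (trueNuis P).pi S a z * (g z * v z)) P :=
    fun v hv => memLp_one_iff_integrable.1 ((hv.bdd_mul_left hgm hgC).bdd_mul_left (C := 1)
      (stronglyMeasurable_pi S a).of_sigmaCov.aestronglyMeasurable (by
        filter_upwards [pi_nonneg (P := P) S a, pi_le_one (P := P) S a] with z h1 h2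
        rwa [abs_of_nonneg h1]))
  simp_rw [mul_sub]
  rw [integral_sub (hi hf) (hi hu), integral_sub (hp (memLp_condMean le_rfl h hf a S)) (hp hu),
    integral_ind_mul_condMean h hf hg hgC]
  congr 1
  exact integral_pi_mul (hg.mul hum) (memLp_one_iff_integrable.1 (hu.bdd_mul_left hgm hgC))

end

end OutcomeModel

namespace OutcomeModel

variable {d : ℕ} {P : Measure (Obs d)} {ε C : ℝ} {S : Finset (Fin d)} {a : Fin 2}
  {f g u : Obs d → ℝ} {ν : Nuisances d}

/-! ### Bias of the plug-in influence functions -/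

/-- Propensity scores given `X_{-S}` that sum to one and are bounded below by `ε`. -/
structure PropensityOK (P : Measure (Obs d)) (ε : ℝ) (ν : Nuisances d) (S : Finset (Fin d)) :
    Prop where
  meas : ∀ a, StronglyMeasurable[sigmaCov S] (ν.pi S a)
  lower : ∀ a, ∀ᵐ z ∂P, ε ≤ ν.pi S a z
  sub : ∀ a, ∀ᵐ z ∂P, ν.pi S (1 - a) z = 1 - ν.pi S a z

/-- A square-integrable outcome regression on all covariates. -/
structure OutcomeOK (P : Measure (Obs d)) (ν : Nuisances d) : Prop where
  meas : ∀ a, StronglyMeasurable[sigmaCov ∅] (ν.mu ∅ a)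
  memLp : ∀ a, MemLp (ν.mu ∅ a) 2 P

/-- Square-integrable regressions given `X_{-S}` whose contrast is bounded by `C`. -/
structure ContrastOK (P : Measure (Obs d)) (C : ℝ) (ν : Nuisances d) (a : Fin 2)
    (S : Finset (Fin d)) : Prop where
  mu_meas : StronglyMeasurable[sigmaCov S] (ν.mu S a)
  reg_meas : StronglyMeasurable[sigmaCov S] (ν.reg S a)
  mu_memLp : MemLp (ν.mu S a) 2 P
  reg_memLp : MemLp (ν.reg S a) 2 P
  bound : ∀ᵐ z ∂P, |contrast ν a S z| ≤ C

/-- Cauchy–Schwarz in `[0, ∞]`, so that no finiteness of the norms has to be tracked. -/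
lemma lintegral_enorm_mul_le (hf : AEStronglyMeasurable f P) (hg : AEStronglyMeasurable g P) :
    ∫⁻ z, ‖f z‖ₑ * ‖g z‖ₑ ∂P ≤ norm2 P f * norm2 P g := by
  have h := ENNReal.lintegral_mul_le_Lp_mul_Lq P Real.HolderConjugate.two_two hf.enorm hg.enorm
  simpa [norm2, eLpNorm_eq_lintegral_rpow_enorm_toReal (p := 2) (by norm_num) (by norm_num)]
    using h

lemma norm2_sub_le (hf : AEStronglyMeasurable f P) (hg : AEStronglyMeasurable g P) :
    norm2 P (f - g) ≤ norm2 P f + norm2 P g := eLpNorm_sub_le hf hg (by norm_num)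

lemma norm2_toReal_sq (hf : MemLp f 2 P) : (norm2 P f).toReal ^ 2 = ∫ z, f z ^ 2 ∂P := by
  rw [norm2, hf.eLpNorm_eq_integral_rpow_norm (by norm_num) (by norm_num),
    ENNReal.toReal_ofReal (by positivity), ← Real.rpow_natCast, ← Real.rpow_mul (by positivity)]
  simp

lemma PropensityOK.le_one (h : PropensityOK P ε ν S) (hε : 0 < ε) (a : Fin 2) :
    ∀ᵐ z ∂P, ν.pi S a z ≤ 1 := by
  filter_upwards [h.lower (1 - a), h.sub a] with z h1 h2
  linarith

lemma PropensityOK.memLp_top (h : PropensityOK P ε ν S) (hε : 0 < ε) (a : Fin 2) :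
    MemLp (ν.pi S a) ∞ P := by
  refine memLp_top_of_bound (h.meas a).of_sigmaCov.aestronglyMeasurable 1 ?_
  filter_upwards [h.le_one hε a, h.lower a] with z h1 h2
  rwa [Real.norm_of_nonneg (hε.le.trans h2)]

lemma PropensityOK.memLp_inv (h : PropensityOK P ε ν S) (hε : 0 < ε) (a : Fin 2) :
    MemLp (fun z => (ν.pi S a z)⁻¹) ∞ P := by
  refine memLp_top_of_bound (h.meas a).of_sigmaCov.inv₀.aestronglyMeasurable ε⁻¹ ?_
  filter_upwards [h.lower a] with z h2
  rw [norm_inv, Real.norm_of_nonneg (hε.le.trans h2)]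
  exact inv_anti₀ hε h2

lemma memLp_ind (a : Fin 2) : MemLp (ind a) ∞ P :=
  memLp_top_of_bound (measurable_ind a).aestronglyMeasurable 1
    (ae_of_all _ fun z => by simpa using abs_ind_le_one a z)

lemma _root_.MeasureTheory.MemLp.top_mul {p : ℝ≥0∞} (hg : MemLp g ∞ P) (hf : MemLp f p P) :
    MemLp (fun z => g z * f z) p P := hf.mul hg

lemma _root_.MeasureTheory.MemLp.exists_bound (hf : MemLp f ∞ P) :
    ∃ C, ∀ᵐ z ∂P, |f z| ≤ C :=
  ⟨(eLpNorm f ∞ P).toReal, by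
    filter_upwards [ae_le_eLpNormEssSup (f := f) (μ := P)] with z hz
    rw [← Real.norm_eq_abs, ← toReal_enorm]
    exact ENNReal.toReal_mono hf.2.ne (by simpa using hz)⟩

/-- The augmented inverse probability weighted outcome in arm `a`. -/
noncomputable def aipw (ν : Nuisances d) (a : Fin 2) (z : Obs d) : ℝ :=
  ν.mu ∅ a z + ind a z * ((ν.pi ∅ a z)⁻¹ * (outc z - ν.mu ∅ a z))

/-- Wherever the indicator of arm `a` is non-zero, `μ_A` is `μ_a`. The bias of `φ` can then be
bounded one arm at a time. -/
lemma phi_eq_aipw (ν : Nuisances d) (z : Obs d) : phi ν z = aipw ν 1 z - aipw ν 0 z := by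
  unfold phi aipw
  obtain ⟨x, b, y⟩ := z
  simp only [ind, expo]
  fin_cases b <;> simp <;> ring

lemma memLp_aipw (hε : 0 < ε) (hY : MemLp (outc (d := d)) 2 P)
    (hp : PropensityOK P ε ν ∅) (hm : OutcomeOK P ν) (a : Fin 2) : MemLp (aipw ν a) 2 P :=
  (hm.memLp a).add ((memLp_ind a).top_mul ((hp.memLp_inv hε a).top_mul (hY.sub (hm.memLp a))))

lemma memLp_phi (hε : 0 < ε) (hY : MemLp (outc (d := d)) 2 P)
    (hp : PropensityOK P ε ν ∅) (hm : OutcomeOK P ν) : MemLp (phi ν) 2 P := by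
  have : phi ν = aipw ν 1 - aipw ν 0 := funext (phi_eq_aipw ν)
  rw [this]
  exact (memLp_aipw hε hY hp hm 1).sub (memLp_aipw hε hY hp hm 0)

variable [IsProbabilityMeasure P]

lemma Overlap.propensityOK (h : Overlap P ε) (S : Finset (Fin d)) :
    PropensityOK P ε (trueNuis P) S :=
  ⟨stronglyMeasurable_pi S, h.2 S, pi_sub S⟩

lemma outcomeOK_true (h : Overlap P ε) (hY : MemLp (outc (d := d)) 2 P) :
    OutcomeOK P (trueNuis P) :=
  ⟨fun a => stronglyMeasurable_condMean a ∅ _, fun a => memLp_condMean (by norm_num) h hY a ∅⟩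

lemma memLp_mu_true (h : Overlap P ε) (hY : MemLp (outc (d := d)) 2 P) (S : Finset (Fin d))
    (a : Fin 2) : MemLp ((trueNuis P).mu S a) 2 P :=
  memLp_condMean (by norm_num) h hY a S

lemma memLp_reg_true (h : Overlap P ε) (hY : MemLp (outc (d := d)) 2 P) (S : Finset (Fin d))
    (a : Fin 2) : MemLp ((trueNuis P).reg S a) 2 P :=
  memLp_condMean (by norm_num) h ((outcomeOK_true h hY).memLp a) _ S

/-- Double robustness: once `1(A = a)(Y - μ̂_a)` is replaced by `π_a (μ_a - μ̂_a)`, the integrand is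
exactly `(π̂_a - π_a)(μ̂_a - μ_a) / π̂_a` up to the sign convention of the factors, and neither
error appears alone. -/
lemma aipw_bias (h : Overlap P ε) (hY : MemLp (outc (d := d)) 2 P)
    (hp : PropensityOK P ε ν ∅) (hm : OutcomeOK P ν) (a : Fin 2) :
    ‖∫ z, aipw ν a z ∂P - ∫ z, (trueNuis P).mu ∅ a z ∂P‖ₑ ≤
      ENNReal.ofReal ε⁻¹ * (norm2 P (ν.pi ∅ a - (trueNuis P).pi ∅ a) *
        norm2 P (ν.mu ∅ a - (trueNuis P).mu ∅ a)) := by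
  have hε := h.1
  have hp0 := h.propensityOK (P := P) ∅
  have hm0 := outcomeOK_true h hY
  have h12 : (1 : ℝ≥0∞) ≤ 2 := by norm_num
  obtain ⟨K, hK⟩ := (hp.memLp_inv hε a).exists_bound
  have i1 := (hm.memLp a).integrable h12
  have i2 := (hm0.memLp a).integrable h12
  have i3 := ((memLp_ind a).top_mul ((hp.memLp_inv hε a).top_mul
    (hY.sub (hm.memLp a)))).integrable h12
  simp only [Pi.sub_apply] at i3
  have i4 := ((hp0.memLp_top hε a).top_mul ((hp.memLp_inv hε a).top_mul
    ((hm0.memLp a).sub (hm.memLp a)))).integrable h12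
  simp only [Pi.sub_apply] at i4
  have e1 : ∫ z, aipw ν a z ∂P - ∫ z, (trueNuis P).mu ∅ a z ∂P
      = ∫ z, (ν.mu ∅ a z + (trueNuis P).pi ∅ a z * ((ν.pi ∅ a z)⁻¹ *
        ((trueNuis P).mu ∅ a z - ν.mu ∅ a z)) - (trueNuis P).mu ∅ a z) ∂P := by
    unfold aipw
    rw [integral_add i1 i3, integral_sub (by exact i1.add i4) i2, integral_add i1 i4]
    congr 2
    exact integral_ind_mul_sub h (hY.mono_exponent h12) ((hm.memLp a).mono_exponent h12)
      (hm.meas a) (hp.meas a).inv₀ hK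
  rw [e1]
  refine (enorm_integral_le_lintegral_enorm _).trans ?_
  have m1 := ((hp.meas a).of_sigmaCov.sub (hp0.meas a).of_sigmaCov).aestronglyMeasurable (μ := P)
  have m2 := ((hm.meas a).of_sigmaCov.sub (hm0.meas a).of_sigmaCov).aestronglyMeasurable (μ := P)
  refine le_trans (lintegral_mono_ae (g := fun z => ENNReal.ofReal ε⁻¹ *
    (‖(ν.pi ∅ a - (trueNuis P).pi ∅ a) z‖ₑ * ‖(ν.mu ∅ a - (trueNuis P).mu ∅ a) z‖ₑ)) ?_) ?_
  · filter_upwards [hp.lower a] with z hz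
    have hz0 : 0 < ν.pi ∅ a z := hε.trans_le hz
    simp only [Pi.sub_apply, Real.enorm_eq_ofReal_abs]
    rw [← ENNReal.ofReal_mul (abs_nonneg _), ← ENNReal.ofReal_mul (by positivity)]
    refine ENNReal.ofReal_le_ofReal ?_
    have : ν.mu ∅ a z + (trueNuis P).pi ∅ a z * ((ν.pi ∅ a z)⁻¹ *
        ((trueNuis P).mu ∅ a z - ν.mu ∅ a z)) - (trueNuis P).mu ∅ a z
        = (ν.pi ∅ a z)⁻¹ * ((ν.pi ∅ a z - (trueNuis P).pi ∅ a z) *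
          (ν.mu ∅ a z - (trueNuis P).mu ∅ a z)) := by
      field_simp; ring
    rw [this, abs_mul, abs_mul, abs_of_pos (inv_pos.2 hz0)]
    exact mul_le_mul_of_nonneg_right (inv_anti₀ hε hz) (by positivity)
  · rw [lintegral_const_mul' _ _ ENNReal.ofReal_ne_top]
    gcongr
    exact lintegral_enorm_mul_le m1 m2

/-- In both the estimated and the true scores the two arms sum to one, so their errors are negatives
of each other. -/
lemma norm2_pi_sub (hp : PropensityOK P ε ν S) (a : Fin 2) :
    norm2 P (ν.pi S a - (trueNuis P).pi S a) = norm2 P (ν.pi S 1 - (trueNuis P).pi S 1) := by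
  obtain rfl | rfl : a = 0 ∨ a = 1 := by omega
  · refine eLpNorm_congr_norm_ae ?_
    filter_upwards [hp.sub 1, pi_sub (P := P) S 1] with z h1 h2
    simp only [sub_self] at h1 h2
    simp only [Pi.sub_apply, h1, h2, Real.norm_eq_abs]
    rw [abs_sub_comm]; congr 1; ring
  · rfl

lemma phi_bias (h : Overlap P ε) (hY : MemLp (outc (d := d)) 2 P)
    (hp : PropensityOK P ε ν ∅) (hm : OutcomeOK P ν) :
    ‖∫ z, phi ν z ∂P - psi P‖ₑ ≤
      ENNReal.ofReal ε⁻¹ * ∑ a : Fin 2, norm2 P (ν.pi ∅ 1 - (trueNuis P).pi ∅ 1) *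
        norm2 P (ν.mu ∅ a - (trueNuis P).mu ∅ a) := by
  have hm0 := outcomeOK_true h hY
  have h12 : (1 : ℝ≥0∞) ≤ 2 := by norm_num
  have e : ∫ z, phi ν z ∂P - psi P = (∫ z, aipw ν 1 z ∂P - ∫ z, (trueNuis P).mu ∅ 1 z ∂P)
      - (∫ z, aipw ν 0 z ∂P - ∫ z, (trueNuis P).mu ∅ 0 z ∂P) := by
    simp_rw [phi_eq_aipw, psi]
    rw [integral_sub ((memLp_aipw h.1 hY hp hm 1).integrable h12)
      ((memLp_aipw h.1 hY hp hm 0).integrable h12),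
      integral_sub ((hm0.memLp 1).integrable h12) ((hm0.memLp 0).integrable h12)]
    ring
  rw [e]
  refine (enorm_sub_le).trans ?_
  rw [Fin.sum_univ_two, mul_add, add_comm]
  have b0 := aipw_bias h hY hp hm 0
  rw [norm2_pi_sub hp 0] at b0
  exact add_le_add b0 (aipw_bias h hY hp hm 1)

lemma memLp_xi (hε : 0 < ε) (hp : PropensityOK P ε ν ∅) (a : Fin 2) : MemLp (xi ν a) 2 P := by
  have h1 := hp.memLp_top hε a
  have h2 : MemLp (fun z => ν.pi ∅ a z * ν.pi ∅ a z + 2 * (ν.pi ∅ a z * (ind a z - ν.pi ∅ a z)))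
    ∞ P := (h1.top_mul h1).add ((h1.top_mul ((memLp_ind a).sub h1)).const_mul 2)
  have h3 : xi ν a = fun z => ν.pi ∅ a z * ν.pi ∅ a z +
      2 * (ν.pi ∅ a z * (ind a z - ν.pi ∅ a z)) := by
    ext z; unfold xi; ring
  rw [h3]
  exact h2.mono_exponent le_top

/-- Since `1(A = a) π̂_a` and `π_a π̂_a` have the same mean, the bias is exactly minus the mean of
`(π̂_a - π_a)²`. -/
lemma xi_bias (h : Overlap P ε) (hp : PropensityOK P ε ν ∅) (a : Fin 2) :
    ‖∫ z, xi ν a z ∂P - normPi P a ^ 2‖ₑ ≤ norm2 P (ν.pi ∅ 1 - (trueNuis P).pi ∅ 1) ^ 2 := by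
  have hε := h.1
  have hp0 := h.propensityOK (P := P) ∅
  have t1 := hp.memLp_top hε a
  have t0 := hp0.memLp_top hε a
  have ti := memLp_ind (P := P) a
  have h1 : (1 : ℝ≥0∞) ≤ ∞ := le_top
  have e : ∫ z, xi ν a z ∂P - normPi P a ^ 2
      = ∫ z, -((ν.pi ∅ a - (trueNuis P).pi ∅ a) z * (ν.pi ∅ a - (trueNuis P).pi ∅ a) z) ∂P := by
    rw [normPi, norm2_toReal_sq (t0.mono_exponent le_top)]
    have e1 : ∀ z, xi ν a z = 2 * (ind a z * ν.pi ∅ a z) - ν.pi ∅ a z * ν.pi ∅ a z := by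
      intro z; unfold xi; ring
    have e2 : ∀ z, -((ν.pi ∅ a - (trueNuis P).pi ∅ a) z * (ν.pi ∅ a - (trueNuis P).pi ∅ a) z)
        = (2 * ((trueNuis P).pi ∅ a z * ν.pi ∅ a z) - ν.pi ∅ a z * ν.pi ∅ a z)
          - (trueNuis P).pi ∅ a z ^ 2 := by
      intro z; simp only [Pi.sub_apply]; ring
    have i1 := (t1.top_mul t1).integrable h1
    have i2 := ((ti.top_mul t1).const_mul 2).integrable h1
    have i3 := ((t0.top_mul t1).const_mul 2).integrable h1
    have i4 : Integrable (fun z => (trueNuis P).pi ∅ a z ^ 2) P := by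
      simpa only [sq] using (t0.top_mul t0).integrable h1
    simp_rw [e1, e2]
    rw [integral_sub i2 i1, integral_sub (by exact i3.sub i1) i4, integral_sub i3 i1,
      integral_const_mul, integral_const_mul, integral_pi_mul (hp.meas a) (t1.integrable h1)]
  rw [e, ← norm2_pi_sub hp a, sq]
  refine (enorm_integral_le_lintegral_enorm _).trans ?_
  simp_rw [enorm_neg, enorm_mul]
  have m1 := ((hp.meas a).of_sigmaCov.sub (hp0.meas a).of_sigmaCov).aestronglyMeasurable (μ := P)
  exact lintegral_enorm_mul_le m1 m1

end OutcomeModel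

namespace OutcomeModel

variable {d : ℕ} {P : Measure (Obs d)} {ε C : ℝ} {S : Finset (Fin d)} {a : Fin 2}
  {f g u : Obs d → ℝ} {ν : Nuisances d}

/-! ### Bias of the estimated measured confounding terms -/

lemma ContrastOK.contrast_meas (h : ContrastOK P C ν a S) :
    StronglyMeasurable[sigmaCov S] (contrast ν a S) := h.mu_meas.sub h.reg_meas

lemma ContrastOK.memLp_top (h : ContrastOK P C ν a S) : MemLp (contrast ν a S) ∞ P :=
  memLp_top_of_bound h.contrast_meas.of_sigmaCov.aestronglyMeasurable C (by simpa using h.bound)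

lemma lam_eq (ν : Nuisances d) (a : Fin 2) (S : Finset (Fin d)) (z : Obs d) :
    lam ν a S z = contrast ν a S z ^ 2 + 2 * (
      ind a z * (contrast ν a S z * (ν.pi S a z)⁻¹ * (outc z - ν.mu S a z))
      - ind a z * (contrast ν a S z * ((ν.pi ∅ a z)⁻¹ * (ν.pi ∅ (1 - a) z * (ν.pi S (1 - a) z)⁻¹))
          * (outc z - ν.mu ∅ a z))
      - ind (1 - a) z * (contrast ν a S z * (ν.pi S (1 - a) z)⁻¹ *
          (ν.mu ∅ a z - ν.reg S a z))) := by
  unfold lam; ring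

/-- Pointwise algebra behind `lam_bias`. Primes mark estimates; `m`, `h` are the two regressions on
`X_{-S}`, `M` is the outcome regression on `X`, and `t` is the conditional mean of `M'` given `A = 1
- a` and `X_{-S}`. The scores of arms `a` and `1 - a` are `p`, `q` given `X_{-S}` and `P`, `Q` given
`X`. The second doubled bracket, which integrates to zero, trades the first-order error `t - h` for
a weighted `M' - M`. That error then meets the correction term in `M - M'`, and their weights agree
up to propensity errors. -/
lemma contrast_remainder_eq {m h m' h' M M' t p q p' q' P Q P' Q' : ℝ}
    (hp : p' ≠ 0) (hq : q ≠ 0) (hq' : q' ≠ 0) (hP : P' ≠ 0)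
    (ep : p = 1 - q) (ep' : p' = 1 - q') (eP : P = 1 - Q) (eP' : P' = 1 - Q') :
    (m' - h') ^ 2 + 2 * (p * ((m' - h') * p'⁻¹ * (m - m'))
        - P * ((m' - h') * (P'⁻¹ * (Q' * q'⁻¹)) * (M - M'))
        - q * ((m' - h') * q'⁻¹ * (t - h')))
      + 2 * (q * ((m' - h') * q⁻¹ * (t - h)) - Q * ((m' - h') * q⁻¹ * (M' - M))) - (m - h) ^ 2
    = -((m' - h') - (m - h)) ^ 2 + 2 * (m' - h') * (
        (p'⁻¹ * ((q - q') * (m' - m))) + q'⁻¹ * ((q' - q) * (t - h'))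
        + (q⁻¹ * P'⁻¹ * q'⁻¹) * ((M - M') * (P' * Q * (q' - q) + q * (Q - Q')))) := by
  subst ep eP
  field_simp
  rw [ep', eP'] at *
  ring

lemma abs_contrast_remainder_le {m h m' h' M M' t p q p' q' P Q P' Q' ε C : ℝ} (hε : 0 < ε)
    (hC : |m' - h'| ≤ C)
    (hp : ε ≤ p') (hq : ε ≤ q) (hq' : ε ≤ q') (hP : ε ≤ P') (hQ : ε ≤ Q) (hQ' : ε ≤ Q')
    (hPp : ε ≤ P) (hpp : ε ≤ p)
    (ep : p = 1 - q) (ep' : p' = 1 - q') (eP : P = 1 - Q) (eP' : P' = 1 - Q') :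
    |(m' - h') ^ 2 + 2 * (p * ((m' - h') * p'⁻¹ * (m - m'))
        - P * ((m' - h') * (P'⁻¹ * (Q' * q'⁻¹)) * (M - M'))
        - q * ((m' - h') * q'⁻¹ * (t - h')))
      + 2 * (q * ((m' - h') * q⁻¹ * (t - h)) - Q * ((m' - h') * q⁻¹ * (M' - M))) - (m - h) ^ 2|
    ≤ (1 + 2 * C * (ε⁻¹ * ε⁻¹ * ε⁻¹)) * (|(m' - h') - (m - h)| * |(m' - h') - (m - h)|
      + |q' - q| * |m' - m| + |q' - q| * |t - h'| + |M' - M| * (|Q' - Q| + |q' - q|)) := by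
  have p0 := hε.trans_le hp
  have q0 := hε.trans_le hq
  have q0' := hε.trans_le hq'
  have P0 := hε.trans_le hP
  rw [contrast_remainder_eq p0.ne' q0.ne' q0'.ne' P0.ne' ep ep' eP eP']
  have hC0 : 0 ≤ C := (abs_nonneg _).trans hC
  -- `ε` is below both `p` and `q`, which sum to one. Hence a single inverse score is also bounded
  -- by the triple product `K`, which the last term of the remainder needs.
  have h1 : 1 ≤ ε⁻¹ := (one_le_inv₀ hε).2 (by linarith)
  have h0 : 0 ≤ ε⁻¹ := by positivity
  have h2 : 1 ≤ ε⁻¹ * ε⁻¹ := one_le_mul_of_one_le_of_one_le h1 h1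
  have h3 : ε⁻¹ ≤ ε⁻¹ * ε⁻¹ * ε⁻¹ := le_mul_of_one_le_left h0 h2
  set K := ε⁻¹ * ε⁻¹ * ε⁻¹ with hK
  have hK0 : 0 ≤ K := by positivity
  have i1 := inv_anti₀ hε hp
  have i2 := inv_anti₀ hε hq
  have i3 := inv_anti₀ hε hq'
  have i4 := inv_anti₀ hε hP
  have j1 : |p'⁻¹ * ((q - q') * (m' - m))| ≤ K * (|q' - q| * |m' - m|) := by
    rw [abs_mul, abs_mul, abs_of_pos (inv_pos.2 p0), abs_sub_comm q]
    exact mul_le_mul_of_nonneg_right (i1.trans h3) (by positivity)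
  have j2 : |q'⁻¹ * ((q' - q) * (t - h'))| ≤ K * (|q' - q| * |t - h'|) := by
    rw [abs_mul, abs_mul, abs_of_pos (inv_pos.2 q0')]
    exact mul_le_mul_of_nonneg_right (i3.trans h3) (by positivity)
  have j4 : |P' * Q * (q' - q) + q * (Q - Q')| ≤ |Q' - Q| + |q' - q| := by
    have k1 : |P' * Q| ≤ 1 := by
      rw [abs_of_nonneg (by nlinarith)]
      exact mul_le_one₀ (by linarith) (by linarith) (by linarith)
    have k2 : |q| ≤ 1 := by rw [abs_of_pos q0]; linarith
    refine (abs_add_le _ _).trans ?_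
    rw [abs_mul _ (q' - q), abs_mul q, abs_sub_comm Q]
    have := mul_le_mul_of_nonneg_right k1 (abs_nonneg (q' - q))
    have := mul_le_mul_of_nonneg_right k2 (abs_nonneg (Q' - Q))
    linarith
  have j3 : |(q⁻¹ * P'⁻¹ * q'⁻¹) * ((M - M') * (P' * Q * (q' - q) + q * (Q - Q')))|
      ≤ K * (|M' - M| * (|Q' - Q| + |q' - q|)) := by
    rw [abs_mul, abs_mul (M - M'), abs_sub_comm M]
    have : |q⁻¹ * P'⁻¹ * q'⁻¹| ≤ K := by
      rw [abs_of_pos (by positivity)]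
      exact mul_le_mul (mul_le_mul i2 i4 (by positivity) h0) i3 (by positivity) (by positivity)
    exact mul_le_mul this (mul_le_mul_of_nonneg_left j4 (abs_nonneg _)) (by positivity) hK0
  refine (abs_add_le _ _).trans ?_
  rw [abs_neg, abs_mul, abs_mul 2, abs_of_pos (two_pos : (0 : ℝ) < 2), abs_pow, sq]
  set A := |(m' - h') - (m - h)|
  have j5 := (abs_add_le _ _).trans (add_le_add ((abs_add_le _ _).trans (add_le_add j1 j2)) j3)
  have j6 := mul_le_mul (mul_le_mul_of_nonneg_left hC two_pos.le) j5 (abs_nonneg _) (by positivity)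
  have j7 : 0 ≤ 2 * C * K * (A * A) := by positivity
  have j8 : 0 ≤ |q' - q| * |m' - m| + |q' - q| * |t - h'| + |M' - M| * (|Q' - Q| + |q' - q|) := by
    positivity
  linarith

section

variable [IsProbabilityMeasure P]

lemma memLp_lam (hε : 0 < ε) (hY : MemLp (outc (d := d)) 2 P)
    (hp : PropensityOK P ε ν ∅) (hpS : PropensityOK P ε ν S) (hm : OutcomeOK P ν)
    (hc : ContrastOK P C ν a S) : MemLp (lam ν a S) 2 P := by
  have tc := hc.memLp_top
  have h1 := (memLp_ind a).top_mul ((tc.top_mul (hpS.memLp_inv hε a)).top_mul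
    (hY.sub hc.mu_memLp))
  have h2 := (memLp_ind a).top_mul ((tc.top_mul ((hp.memLp_inv hε a).top_mul
    ((hp.memLp_top hε (1 - a)).top_mul (hpS.memLp_inv hε (1 - a))))).top_mul
    (hY.sub (hm.memLp a)))
  have h3 := (memLp_ind (1 - a)).top_mul ((tc.top_mul (hpS.memLp_inv hε (1 - a))).top_mul
    ((hm.memLp a).sub hc.reg_memLp))
  have h4 : MemLp (fun z => contrast ν a S z ^ 2) 2 P := by
    simpa only [sq] using (tc.top_mul tc).mono_exponent le_top
  have e : lam ν a S = _ := funext (lam_eq ν a S)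
  rw [e]
  exact h4.add (((h1.sub h2).sub h3).const_mul 2)

/-- Replacing each weighted residual by its conditional mean leaves an integrand in the nuisance
functions only. After the mean-zero correction it is dominated pointwise by products of two errors,
by `abs_contrast_remainder_le`. -/
lemma lam_bias (h : Overlap P ε) (hY : MemLp (outc (d := d)) 2 P)
    (hp : PropensityOK P ε ν ∅) (hpS : PropensityOK P ε ν S) (hm : OutcomeOK P ν)
    (hc : ContrastOK P C ν a S) :
    ‖∫ z, lam ν a S z ∂P - (norm2 P (contrast (trueNuis P) a S)).toReal ^ 2‖ₑ ≤
      ENNReal.ofReal (1 + 2 * C * (ε⁻¹ * ε⁻¹ * ε⁻¹)) * errorProducts P ν a S := by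
  have hε := h.1
  have h12 : (1 : ℝ≥0∞) ≤ 2 := by norm_num
  have hm0 := outcomeOK_true h hY
  have hpt := h.propensityOK (P := P) ∅
  have hpSt := h.propensityOK (P := P) S
  have mM : MemLp ((trueNuis P).mu ∅ a) 2 P := hm0.memLp a
  have mMm : StronglyMeasurable[sigmaCov ∅] ((trueNuis P).mu ∅ a) := hm0.meas a
  have mm : MemLp ((trueNuis P).mu S a) 2 P := memLp_mu_true h hY S a
  have mh : MemLp ((trueNuis P).reg S a) 2 P := memLp_reg_true h hY S a
  have mt : MemLp (condMean P (1 - a) S (ν.mu ∅ a)) 2 P := memLp_condMean h12 h (hm.memLp a) _ S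
  have cm : MemLp (contrast (trueNuis P) a S) 2 P := mm.sub mh
  have tc := hc.memLp_top
  have tP := hpt.memLp_top hε a
  have tQ := hpt.memLp_top hε (1 - a)
  have tp := hpSt.memLp_top hε a
  have tq := hpSt.memLp_top hε (1 - a)
  have vq := hpSt.memLp_inv hε (1 - a)
  have vp' := hpS.memLp_inv hε a
  have vq' := hpS.memLp_inv hε (1 - a)
  have vP' := hp.memLp_inv hε a
  have tQ' := hp.memLp_top hε (1 - a)
  have b1 := tc.top_mul vp'
  have b2 := tc.top_mul (vP'.top_mul (tQ'.top_mul vq'))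
  have b3 := tc.top_mul vq'
  have b4 := tc.top_mul vq
  have sb1 := hc.contrast_meas.mul (hpS.meas a).inv₀
  have sb2 := (hc.contrast_meas.mono (sigmaCov_le_empty S)).mul ((hp.meas a).inv₀.mul
    ((hp.meas (1 - a)).mul ((hpS.meas (1 - a)).mono (sigmaCov_le_empty S)).inv₀))
  have sb3 := hc.contrast_meas.mul (hpS.meas (1 - a)).inv₀
  have sb4 := hc.contrast_meas.mul (hpSt.meas (1 - a)).inv₀
  obtain ⟨K1, hK1⟩ := b1.exists_bound
  obtain ⟨K2, hK2⟩ := b2.exists_bound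
  obtain ⟨K3, hK3⟩ := b3.exists_bound
  obtain ⟨K4, hK4⟩ := b4.exists_bound
  have L1 : ∀ {v : Obs d → ℝ}, MemLp v 2 P → MemLp v 1 P := fun hv => hv.mono_exponent h12
  have e1 := integral_ind_mul_sub (a := a) h (L1 hY) (L1 hc.mu_memLp) hc.mu_meas sb1 hK1
  have e2 := integral_ind_mul_sub (a := a) h (L1 hY) (L1 (hm.memLp a)) (hm.meas a) sb2 hK2
  have e3 := integral_ind_mul_sub (a := 1 - a) h (L1 (hm.memLp a)) (L1 hc.reg_memLp) hc.reg_meas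
    sb3 hK3
  -- Both sides are the mean of `1(A = 1 - a)` times the same weight times `μ̂_a(X) - μ_a(X)`,
  -- conditioned on `X_{-S}` on the left and on `X` on the right. The true `reg` enters as the
  -- conditional mean of the true `μ_a(X)`.
  have e4 : ∫ z, (trueNuis P).pi S (1 - a) z * (contrast ν a S z *
        ((trueNuis P).pi S (1 - a) z)⁻¹ *
        (condMean P (1 - a) S (ν.mu ∅ a) z - (trueNuis P).reg S a z)) ∂P
      = ∫ z, (trueNuis P).pi ∅ (1 - a) z * (contrast ν a S z *
        ((trueNuis P).pi S (1 - a) z)⁻¹ * (ν.mu ∅ a z - (trueNuis P).mu ∅ a z)) ∂P := by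
    have key : ∀ ⦃v : Obs d → ℝ⦄, MemLp v 2 P → StronglyMeasurable[sigmaCov ∅] v →
        ∫ z, (trueNuis P).pi S (1 - a) z * (contrast ν a S z *
          ((trueNuis P).pi S (1 - a) z)⁻¹ * condMean P (1 - a) S v z) ∂P
        = ∫ z, (trueNuis P).pi ∅ (1 - a) z * (contrast ν a S z *
          ((trueNuis P).pi S (1 - a) z)⁻¹ * v z) ∂P := by
      intro v hv hvm
      exact (integral_ind_mul_condMean h (L1 hv) sb4 hK4).symm.trans
        (integral_pi_mul ((sb4.mono (sigmaCov_le_empty S)).mul hvm)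
          ((b4.top_mul hv).integrable h12))
    simp_rw [mul_sub]
    rw [integral_sub ((tq.top_mul (b4.top_mul mt)).integrable h12)
        ((tq.top_mul (b4.top_mul mh)).integrable h12),
      integral_sub ((tQ.top_mul (b4.top_mul (hm.memLp a))).integrable h12)
        ((tQ.top_mul (b4.top_mul mM)).integrable h12)]
    exact congr_arg₂ _ (key (hm.memLp a) (hm.meas a)) (key mM mMm)
  have i0 : Integrable (fun z => contrast ν a S z ^ 2) P := by
    simpa only [sq] using (tc.top_mul tc).integrable le_top
  have i00 : Integrable (fun z => contrast (trueNuis P) a S z ^ 2) P := cm.integrable_sq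
  have i1 := ((memLp_ind a).top_mul (b1.top_mul (hY.sub hc.mu_memLp))).integrable h12
  have i2 := ((memLp_ind a).top_mul (b2.top_mul (hY.sub (hm.memLp a)))).integrable h12
  have i3 := ((memLp_ind (1 - a)).top_mul (b3.top_mul
    ((hm.memLp a).sub hc.reg_memLp))).integrable h12
  have j1 := (tp.top_mul (b1.top_mul (mm.sub hc.mu_memLp))).integrable h12
  have j2 := (tP.top_mul (b2.top_mul (mM.sub (hm.memLp a)))).integrable h12
  have j3 := (tq.top_mul (b3.top_mul (mt.sub hc.reg_memLp))).integrable h12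
  have j4 := (tq.top_mul (b4.top_mul (mt.sub mh))).integrable h12
  have j5 := (tQ.top_mul (b4.top_mul ((hm.memLp a).sub mM))).integrable h12
  simp only [Pi.sub_apply] at i1 i2 i3 j1 j2 j3 j4 j5
  -- The second doubled bracket on the right has integral zero by `e4`; it is inserted to match
  -- `contrast_remainder_eq`.
  have e : ∫ z, lam ν a S z ∂P - (norm2 P (contrast (trueNuis P) a S)).toReal ^ 2
      = ∫ z, (contrast ν a S z ^ 2 + 2 * (
          (trueNuis P).pi S a z * (contrast ν a S z * (ν.pi S a z)⁻¹ *
            ((trueNuis P).mu S a z - ν.mu S a z))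
          - (trueNuis P).pi ∅ a z * (contrast ν a S z *
            ((ν.pi ∅ a z)⁻¹ * (ν.pi ∅ (1 - a) z * (ν.pi S (1 - a) z)⁻¹)) *
            ((trueNuis P).mu ∅ a z - ν.mu ∅ a z))
          - (trueNuis P).pi S (1 - a) z * (contrast ν a S z * (ν.pi S (1 - a) z)⁻¹ *
            (condMean P (1 - a) S (ν.mu ∅ a) z - ν.reg S a z)))
        + 2 * ((trueNuis P).pi S (1 - a) z * (contrast ν a S z *
            ((trueNuis P).pi S (1 - a) z)⁻¹ *
            (condMean P (1 - a) S (ν.mu ∅ a) z - (trueNuis P).reg S a z))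
          - (trueNuis P).pi ∅ (1 - a) z * (contrast ν a S z *
            ((trueNuis P).pi S (1 - a) z)⁻¹ * (ν.mu ∅ a z - (trueNuis P).mu ∅ a z)))
        - contrast (trueNuis P) a S z ^ 2) ∂P := by
    rw [norm2_toReal_sq cm]
    simp_rw [lam_eq]
    rw [integral_add i0 (by exact ((i1.sub i2).sub i3).const_mul 2), integral_const_mul,
      integral_sub (by exact i1.sub i2) i3, integral_sub i1 i2,
      integral_sub
        (by exact (i0.add (((j1.sub j2).sub j3).const_mul 2)).add ((j4.sub j5).const_mul 2)) i00,
      integral_add (by exact i0.add (((j1.sub j2).sub j3).const_mul 2))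
        (by exact (j4.sub j5).const_mul 2),
      integral_add i0 (by exact ((j1.sub j2).sub j3).const_mul 2), integral_const_mul,
      integral_sub (by exact j1.sub j2) j3, integral_sub j1 j2, integral_const_mul,
      integral_sub j4 j5, e4, sub_self, mul_zero, add_zero]
    congr 4
    exact congr_arg₂ _ e1 e2
  rw [e]
  refine (enorm_integral_le_lintegral_enorm _).trans ?_
  have hC0 : 0 ≤ C := by
    obtain ⟨z, hz⟩ := hc.bound.exists
    exact (abs_nonneg _).trans hz
  have hK0 : 0 ≤ 1 + 2 * C * (ε⁻¹ * ε⁻¹ * ε⁻¹) := by positivity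
  have am : ∀ {v w : Obs d → ℝ}, AEStronglyMeasurable v P → AEStronglyMeasurable w P →
      AEStronglyMeasurable (v - w) P := fun hv hw => hv.sub hw
  have m0 : AEStronglyMeasurable (contrast ν a S - contrast (trueNuis P) a S) P := am tc.1 cm.1
  have m1 := am hc.mu_memLp.1 mm.1
  have m2 := am hc.reg_memLp.1 mh.1
  have m3 := am (hpS.memLp_top hε (1 - a)).1 tq.1
  have m4 := am (hm.memLp a).1 mM.1
  have m5 := am tQ'.1 tQ.1
  have m6 := am mt.1 hc.reg_memLp.1
  refine le_trans (lintegral_mono_ae (g := fun z =>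
    ENNReal.ofReal (1 + 2 * C * (ε⁻¹ * ε⁻¹ * ε⁻¹)) * (
      ‖(contrast ν a S - contrast (trueNuis P) a S) z‖ₑ *
        ‖(contrast ν a S - contrast (trueNuis P) a S) z‖ₑ
      + ‖(ν.pi S (1 - a) - (trueNuis P).pi S (1 - a)) z‖ₑ *
        ‖(ν.mu S a - (trueNuis P).mu S a) z‖ₑ
      + ‖(ν.pi S (1 - a) - (trueNuis P).pi S (1 - a)) z‖ₑ *
        ‖(condMean P (1 - a) S (ν.mu ∅ a) - ν.reg S a) z‖ₑ
      + (‖(ν.mu ∅ a - (trueNuis P).mu ∅ a) z‖ₑ *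
          ‖(ν.pi ∅ (1 - a) - (trueNuis P).pi ∅ (1 - a)) z‖ₑ +
        ‖(ν.mu ∅ a - (trueNuis P).mu ∅ a) z‖ₑ *
          ‖(ν.pi S (1 - a) - (trueNuis P).pi S (1 - a)) z‖ₑ))) ?_) ?_
  · filter_upwards [hc.bound, hp.lower a, hp.lower (1 - a), hpS.lower a, hpS.lower (1 - a),
      hpt.lower a, hpt.lower (1 - a), hpSt.lower a, hpSt.lower (1 - a), hp.sub a, hpS.sub a,
      hpt.sub a, hpSt.sub a] with z hb l1 l2 l3 l4 l5 l6 l7 l8 s1 s2 s3 s4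
    have := abs_contrast_remainder_le (m := (trueNuis P).mu S a z) (h := (trueNuis P).reg S a z)
      (m' := ν.mu S a z) (h' := ν.reg S a z) (M := (trueNuis P).mu ∅ a z) (M' := ν.mu ∅ a z)
      (t := condMean P (1 - a) S (ν.mu ∅ a) z) hε hb l3 l8 l4 l1 l6 l2 l5 l7
      (p := (trueNuis P).pi S a z) (by linarith) (by linarith) (by linarith) (by linarith)
    simp only [Pi.sub_apply, Real.enorm_eq_ofReal_abs]
    simp only [← ENNReal.ofReal_mul (abs_nonneg _)]
    repeat rw [← ENNReal.ofReal_add (by positivity) (by positivity)]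
    rw [← ENNReal.ofReal_mul hK0, ← mul_add]
    exact ENNReal.ofReal_le_ofReal this
  · rw [lintegral_const_mul' _ _ ENNReal.ofReal_ne_top]
    refine mul_le_mul_right ?_ _
    rw [lintegral_add_left' (by
        exact ((m0.enorm.mul m0.enorm).add (m3.enorm.mul m1.enorm)).add (m3.enorm.mul m6.enorm)),
      lintegral_add_left' (by exact (m0.enorm.mul m0.enorm).add (m3.enorm.mul m1.enorm)),
      lintegral_add_left' (by exact m0.enorm.mul m0.enorm),
      lintegral_add_left' (by exact m4.enorm.mul m5.enorm)]
    unfold errorProducts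
    refine add_le_add (add_le_add (add_le_add ?_ (lintegral_enorm_mul_le m3 m1))
      (lintegral_enorm_mul_le m3 m6)) ?_
    · have : norm2 P (contrast ν a S - contrast (trueNuis P) a S) ≤
          norm2 P (ν.mu S a - (trueNuis P).mu S a) +
            norm2 P (ν.reg S a - (trueNuis P).reg S a) := by
        have e : contrast ν a S - contrast (trueNuis P) a S
            = (ν.mu S a - (trueNuis P).mu S a) - (ν.reg S a - (trueNuis P).reg S a) := by
          ext z; simp only [contrast, Pi.sub_apply]; ring
        rw [e]; exact norm2_sub_le m1 m2
      refine (lintegral_enorm_mul_le m0 m0).trans ?_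
      rw [sq]
      exact mul_le_mul' this this
    · rw [mul_add]
      exact add_le_add (lintegral_enorm_mul_le m4 m5) (lintegral_enorm_mul_le m4 m3)

end

end OutcomeModel

namespace OutcomeModel

/-! ### Stochastic order calculus -/

section StochasticOrder

variable {Ω : Type*} [MeasurableSpace Ω] {Pr : Measure Ω} {X Y : ℕ → Ω → ℝ≥0∞} {r : ℕ → ℝ}

/-- `X_n = O_P(r_n)`, for `[0, ∞]`-valued `X_n`. -/
def IsBigOP (Pr : Measure Ω) (X : ℕ → Ω → ℝ≥0∞) (r : ℕ → ℝ) : Prop :=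
  ∀ δ : ℝ≥0∞, 0 < δ → ∃ C : ℝ, 0 < C ∧
    ∀ᶠ n in atTop, Pr {ω | ENNReal.ofReal (C * r n) < X n ω} ≤ δ

lemma IsLittleOP.isBigOP (h : IsLittleOP Pr X r) : IsBigOP Pr X r := fun _ hδ =>
  ⟨1, one_pos, ((h 1 one_pos).eventually_le_const hδ)⟩

lemma measure_le_of_ae_imp {A B D : Set Ω} (h : ∀ᵐ ω ∂Pr, ω ∈ A → ω ∈ B ∨ ω ∈ D) :
    Pr A ≤ Pr B + Pr D :=
  (measure_mono_ae (t := B ∪ D) (by filter_upwards [h] with ω hω using hω)).trans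
    (measure_union_le _ _)

/-- Domination outside events of small probability. -/
lemma IsLittleOP.of_le_outside (hX : IsLittleOP Pr X r)
    (h : ∀ δ : ℝ≥0∞, 0 < δ → ∃ K : ℝ, 0 < K ∧ ∃ B : ℕ → Set Ω, (∀ᶠ n in atTop, Pr (B n) ≤ δ) ∧
      ∀ n, ∀ᵐ ω ∂Pr, ω ∉ B n → Y n ω ≤ ENNReal.ofReal K * X n ω) : IsLittleOP Pr Y r := by
  intro ε hε
  rw [ENNReal.tendsto_nhds_zero]
  intro δ hδ
  have hδ2 : 0 < δ / 2 := ENNReal.half_pos hδ.ne'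
  obtain ⟨K, hK, B, hB, hle⟩ := h (δ / 2) hδ2
  filter_upwards [hB, (hX (ε / K) (by positivity)).eventually_le_const hδ2] with n h1 h2
  refine (measure_le_of_ae_imp (B := {ω | ENNReal.ofReal (ε / K * r n) < X n ω}) (D := B n)
    ?_).trans ((add_le_add h2 h1).trans (ENNReal.add_halves δ).le)
  filter_upwards [hle n] with ω hω hlt
  by_cases hb : ω ∈ B n
  · exact Or.inr hb
  · refine Or.inl ?_
    by_contra hcon
    simp only [not_lt] at hcon hlt
    refine absurd hlt (not_lt.2 ((hω hb).trans ?_))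
    calc _ ≤ ENNReal.ofReal K * ENNReal.ofReal (ε / K * r n) := by gcongr
      _ = ENNReal.ofReal (ε * r n) := by
        rw [← ENNReal.ofReal_mul hK.le]; congr 1; field_simp

lemma IsLittleOP.of_ae_le {K : ℝ} (hX : IsLittleOP Pr X r)
    (h : ∀ n, ∀ᵐ ω ∂Pr, Y n ω ≤ ENNReal.ofReal K * X n ω) : IsLittleOP Pr Y r :=
  hX.of_le_outside fun δ _ => ⟨|K| + 1, by positivity, fun _ => ∅, by simp, fun n => by
    filter_upwards [h n] with ω hω _
    exact hω.trans (by gcongr; linarith [le_abs_self K])⟩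

lemma IsLittleOP.mono (hX : IsLittleOP Pr X r) (h : ∀ n ω, Y n ω ≤ X n ω) :
    IsLittleOP Pr Y r :=
  hX.of_ae_le (K := 1) fun n => ae_of_all _ fun ω => by simpa using h n ω

lemma IsBigOP.mono (hX : IsBigOP Pr X r) (h : ∀ n ω, Y n ω ≤ X n ω) : IsBigOP Pr Y r := by
  intro δ hδ
  obtain ⟨C, hC, hC'⟩ := hX δ hδ
  exact ⟨C, hC, hC'.mono fun n hn =>
    (measure_mono fun ω (hω : _ < _) => hω.trans_le (h n ω)).trans hn⟩

lemma IsLittleOP.add (hX : IsLittleOP Pr X r) (hY : IsLittleOP Pr Y r) :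
    IsLittleOP Pr (fun n ω => X n ω + Y n ω) r := by
  intro ε hε
  have h := (hX (ε / 2) (by positivity)).add (hY (ε / 2) (by positivity))
  rw [add_zero] at h
  refine tendsto_of_tendsto_of_tendsto_of_le_of_le tendsto_const_nhds h (fun _ => zero_le)
    fun n => measure_le_of_ae_imp (ae_of_all _ fun ω hω => ?_)
  by_contra! hcon
  simp only [Set.mem_ofPred_eq, not_lt] at hcon hω
  refine absurd hω (not_lt.2 ((add_le_add hcon.1 hcon.2).trans ?_))
  rcases le_total 0 (r n) with h0 | h0
  · rw [← ENNReal.ofReal_add (by positivity) (by positivity)]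
    exact ENNReal.ofReal_le_ofReal (by linarith)
  · rw [ENNReal.ofReal_of_nonpos (mul_nonpos_of_nonneg_of_nonpos (by positivity) h0)]
    simp

lemma IsBigOP.add (hX : IsBigOP Pr X r) (hY : IsBigOP Pr Y r) :
    IsBigOP Pr (fun n ω => X n ω + Y n ω) r := by
  intro δ hδ
  have hδ2 : 0 < δ / 2 := ENNReal.half_pos hδ.ne'
  obtain ⟨C, hC, hC'⟩ := hX _ hδ2
  obtain ⟨D, hD, hD'⟩ := hY _ hδ2
  refine ⟨C + D, by positivity, ?_⟩
  filter_upwards [hC', hD'] with n h1 h2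
  refine (measure_le_of_ae_imp (ae_of_all _ fun ω hω => ?_)).trans
    ((add_le_add h1 h2).trans (ENNReal.add_halves δ).le)
  by_contra! hcon
  simp only [Set.mem_ofPred_eq, not_lt] at hcon hω
  refine absurd hω (not_lt.2 ((add_le_add hcon.1 hcon.2).trans ?_))
  rcases le_total 0 (r n) with h0 | h0
  · rw [← ENNReal.ofReal_add (by positivity) (by positivity)]
    exact ENNReal.ofReal_le_ofReal (by linarith)
  · rw [ENNReal.ofReal_of_nonpos (mul_nonpos_of_nonneg_of_nonpos hC.le h0),
      ENNReal.ofReal_of_nonpos (mul_nonpos_of_nonneg_of_nonpos hD.le h0)]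
    simp

lemma IsLittleOP.zero : IsLittleOP Pr (fun _ _ => 0) r := fun ε _ => by simp

lemma IsLittleOP.sum {ι : Type*} {s : Finset ι} {X : ι → ℕ → Ω → ℝ≥0∞}
    (h : ∀ i ∈ s, IsLittleOP Pr (X i) r) : IsLittleOP Pr (fun n ω => ∑ i ∈ s, X i n ω) r := by
  classical
  induction s using Finset.induction_on with
  | empty => simpa using IsLittleOP.zero
  | insert i s hi ih =>
    simp only [Finset.sum_insert hi]
    exact (h i (Finset.mem_insert_self _ _)).add
      (ih fun j hj => h j (Finset.mem_insert_of_mem hj))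

lemma IsLittleOP.enorm_add {U V : ℕ → Ω → ℝ} (hU : IsLittleOP Pr (fun n ω => ‖U n ω‖ₑ) r)
    (hV : IsLittleOP Pr (fun n ω => ‖V n ω‖ₑ) r) :
    IsLittleOP Pr (fun n ω => ‖U n ω + V n ω‖ₑ) r :=
  (hU.add hV).mono fun _ _ => enorm_add_le _ _

lemma IsLittleOP.enorm_const_mul {U : ℕ → Ω → ℝ} (c : ℝ)
    (hU : IsLittleOP Pr (fun n ω => ‖U n ω‖ₑ) r) :
    IsLittleOP Pr (fun n ω => ‖c * U n ω‖ₑ) r :=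
  hU.of_ae_le (K := |c|) fun n => ae_of_all _ fun ω => by
    rw [enorm_mul, Real.enorm_eq_ofReal_abs c]

lemma IsLittleOP.enorm_sum {ι : Type*} {s : Finset ι} {U : ι → ℕ → Ω → ℝ}
    (h : ∀ i ∈ s, IsLittleOP Pr (fun n ω => ‖U i n ω‖ₑ) r) :
    IsLittleOP Pr (fun n ω => ‖∑ i ∈ s, U i n ω‖ₑ) r :=
  (IsLittleOP.sum h).mono fun _ _ => enorm_sum_le _ _

variable {E F : Type*} [NormedAddCommGroup E] [NormedSpace ℝ E] [NormedAddCommGroup F]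
  [NormedSpace ℝ F]

/-- The delta method, as a stochastic expansion. -/
lemma IsBigOP.delta {f : E → F} {f' : E →L[ℝ] F} {x : E} (hf : HasFDerivAt f f' x)
    {U : ℕ → Ω → E} (hU : IsBigOP Pr (fun n ω => ‖U n ω - x‖ₑ) r) (hr0 : ∀ n, 0 ≤ r n)
    (hr : Tendsto r atTop (𝓝 0)) :
    IsLittleOP Pr (fun n ω => ‖f (U n ω) - f x - f' (U n ω - x)‖ₑ) r := by
  intro ε hε
  rw [ENNReal.tendsto_nhds_zero]
  intro δ hδ
  obtain ⟨C, hC, hC'⟩ := hU δ hδ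
  -- With slope `ε / C`, the linearisation error on `‖U n ω - x‖ ≤ C r_n` is at most `ε r_n`.
  have h1 := (hasFDerivAt_iff_isLittleO.1 hf).def (c := ε / C) (by positivity)
  obtain ⟨ρ, hρ, hball⟩ := Metric.eventually_nhds_iff.1 h1
  have h2 : ∀ᶠ n in atTop, C * r n < ρ := by
    have : Tendsto (fun n => C * r n) atTop (𝓝 0) := by simpa using hr.const_mul C
    exact this.eventually_lt_const hρ
  filter_upwards [hC', h2] with n hn hn2
  refine (measure_mono fun ω hω => ?_).trans hn
  by_contra hcon
  simp only [Set.mem_ofPred_eq, not_lt] at hcon hω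
  have hCr : 0 ≤ C * r n := mul_nonneg hC.le (hr0 n)
  rw [← ofReal_norm, ENNReal.ofReal_le_ofReal_iff hCr] at hcon
  refine absurd hω (not_lt.2 ?_)
  rw [← ofReal_norm]
  refine ENNReal.ofReal_le_ofReal ((hball (by rw [dist_eq_norm]; linarith)).trans ?_)
  calc ε / C * ‖U n ω - x‖ ≤ ε / C * (C * r n) := by gcongr
    _ = ε * r n := by field_simp

end StochasticOrder

/-! ### Sample means and sample splitting -/

section Sampling

variable {d : ℕ} {P : Measure (Obs d)} {f g : Obs d → ℝ}

lemma sampleMean_add {n : ℕ} (s : Fin n → Obs d) (f g : Obs d → ℝ) :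
    sampleMean s (f + g) = sampleMean s f + sampleMean s g := by
  simp [sampleMean, Finset.sum_add_distrib, mul_add]

lemma sampleMean_const_mul {n : ℕ} (s : Fin n → Obs d) (c : ℝ) (f : Obs d → ℝ) :
    sampleMean s (fun z => c * f z) = c * sampleMean s f := by
  simp only [sampleMean, ← Finset.mul_sum]; ring

/-- The centered sample mean `(P_n - E) f`. -/
noncomputable def empProc (P : Measure (Obs d)) {n : ℕ} (s : Fin n → Obs d) (f : Obs d → ℝ) : ℝ :=
  sampleMean s f - ∫ z, f z ∂P

lemma empProc_add {n : ℕ} (s : Fin n → Obs d) (hf : Integrable f P) (hg : Integrable g P) :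
    empProc P s (fun z => f z + g z) = empProc P s f + empProc P s g := by
  have := sampleMean_add s f g
  simp only [empProc, integral_add hf hg]
  change sampleMean s (f + g) - _ = _
  rw [this]; ring

lemma empProc_const_mul {n : ℕ} (s : Fin n → Obs d) (c : ℝ) (f : Obs d → ℝ) :
    empProc P s (fun z => c * f z) = c * empProc P s f := by
  rw [empProc, sampleMean_const_mul, integral_const_mul, empProc]; ring

lemma empProc_sum {ι : Type*} {n : ℕ} (s : Fin n → Obs d) (t : Finset ι) {f : ι → Obs d → ℝ}
    (hf : ∀ i ∈ t, Integrable (f i) P) :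
    empProc P s (fun z => ∑ i ∈ t, f i z) = ∑ i ∈ t, empProc P s (f i) := by
  classical
  induction t using Finset.induction_on with
  | empty => simp [empProc, sampleMean]
  | insert i t hi ih =>
    have h1 : ∀ j ∈ t, Integrable (f j) P := fun j hj => hf j (Finset.mem_insert_of_mem hj)
    simp only [Finset.sum_insert hi]
    rw [empProc_add s (hf i (Finset.mem_insert_self _ _)) (integrable_finsetSum t h1), ih h1]

variable {Ω : Type*} [MeasurableSpace Ω] {Pr : Measure Ω} {Z T : ℕ → Ω → Obs d}

lemma measurable_firstN (hZ : ∀ i, Measurable (Z i)) (n : ℕ) : Measurable (firstN Z n) :=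
  measurable_pi_lambda _ fun i => hZ i

/-- The two samples are functions of disjoint blocks of one independent family. -/
lemma indepFun_firstN (hZ : ∀ i, Measurable (Z i)) (hT : ∀ i, Measurable (T i))
    (hindep : iIndepFun (Sum.elim Z T) Pr) (n : ℕ) :
    IndepFun (firstN T n) (firstN Z n) Pr := by
  classical
  have hm : ∀ i, Measurable (Sum.elim Z T i) := by rintro (i | i); exacts [hZ i, hT i]
  let A : Finset (ℕ ⊕ ℕ) := (Finset.range n).image Sum.inr
  let B : Finset (ℕ ⊕ ℕ) := (Finset.range n).image Sum.inl
  have hAB : Disjoint A B := by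
    rw [Finset.disjoint_left]; intro x hx hx'
    simp only [A, B, Finset.mem_image] at hx hx'
    obtain ⟨i, -, rfl⟩ := hx
    obtain ⟨j, -, hj⟩ := hx'
    cases hj
  have h := hindep.indepFun_finset A B hAB hm
  let φ : (A → Obs d) → Fin n → Obs d := fun x i => x ⟨Sum.inr i, by simp [A]⟩
  let ψ : (B → Obs d) → Fin n → Obs d := fun x i => x ⟨Sum.inl i, by simp [B]⟩
  exact h.comp (φ := φ) (ψ := ψ) (by fun_prop) (by fun_prop)

variable [IsProbabilityMeasure Pr]

lemma variance_sampleMean_le (hZ : ∀ i, Measurable (Z i)) (hlaw : ∀ i, Pr.map (Z i) = P)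
    (hind : iIndepFun Z Pr) (hg : Measurable g) (hg2 : MemLp g 2 P) {n : ℕ} (hn : n ≠ 0) :
    MemLp (fun ω => sampleMean (firstN Z n ω) g) 2 Pr ∧
    ∫ ω, sampleMean (firstN Z n ω) g ∂Pr = ∫ z, g z ∂P ∧
    Var[fun ω => sampleMean (firstN Z n ω) g; Pr] ≤ (norm2 P g).toReal ^ 2 / n := by
  have hn' : (n : ℝ) ≠ 0 := by exact_mod_cast hn
  have hmem : ∀ i, MemLp (fun ω => g (Z i ω)) 2 Pr := fun i => by
    have := hlaw i ▸ hg2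
    exact (memLp_map_measure_iff hg.aestronglyMeasurable (hZ i).aemeasurable).1 this
  have hint : ∀ i, ∫ ω, g (Z i ω) ∂Pr = ∫ z, g z ∂P := fun i => by
    rw [← hlaw i, integral_map (hZ i).aemeasurable hg.aestronglyMeasurable]
  have hvar : ∀ i, Var[fun ω => g (Z i ω); Pr] ≤ (norm2 P g).toReal ^ 2 := fun i => by
    refine (variance_le_expectation_sq (hmem i).1).trans ?_
    rw [norm2_toReal_sq hg2, ← hlaw i,
      integral_map (hZ i).aemeasurable (hg.pow_const 2).aestronglyMeasurable]
    simp
  have heq : (fun ω => sampleMean (firstN Z n ω) g)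
      = fun ω => (1 / (n : ℝ)) * (∑ i : Fin n, fun ω => g (Z i ω)) ω := by
    ext ω; simp [sampleMean, firstN]
  have hs : MemLp (∑ i : Fin n, fun ω => g (Z i ω)) 2 Pr :=
    memLp_finsetSum' _ fun i _ => hmem i
  refine ⟨?_, ?_, ?_⟩
  · rw [heq]; exact hs.const_mul _
  · simp only [sampleMean, firstN]
    rw [integral_const_mul,
      integral_finsetSum _ fun (i : Fin n) _ => (hmem i).integrable (by norm_num)]
    simp only [hint, Finset.sum_const, Finset.card_univ, Fintype.card_fin, nsmul_eq_mul]
    field_simp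
  · rw [heq, variance_const_mul, IndepFun.variance_sum (fun (i : Fin n) _ => hmem i)]
    · have h1 : ∑ i : Fin n, Var[fun ω => g (Z i ω); Pr] ≤ n * (norm2 P g).toReal ^ 2 := by
        refine (Finset.sum_le_sum fun (i : Fin n) _ => hvar i).trans ?_
        simp
      calc _ ≤ (1 / (n : ℝ)) ^ 2 * (n * (norm2 P g).toReal ^ 2) := by gcongr
        _ = _ := by field_simp
    · intro i _ j _ hij
      exact (hind.indepFun (Fin.val_injective.ne hij)).comp hg hg

/-- At the scale `n^{-1/2}` the factors of `n` cancel, and the bound depends on `g` only through its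
`L_2` norm. This uniformity is what allows `g` to be an estimate frozen at the training sample. -/
lemma chebyshev_empProc (hZ : ∀ i, Measurable (Z i)) (hlaw : ∀ i, Pr.map (Z i) = P)
    (hind : iIndepFun Z Pr) (hg : Measurable g) (hg2 : MemLp g 2 P) {n : ℕ} (hn : n ≠ 0)
    {η : ℝ} (hη : 0 < η) :
    Pr {ω | ENNReal.ofReal (η * (n : ℝ) ^ (-(1 / 2) : ℝ)) < ‖empProc P (firstN Z n ω) g‖ₑ} ≤
      ENNReal.ofReal ((norm2 P g).toReal ^ 2 / η ^ 2) := by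
  obtain ⟨h1, h2, h3⟩ := variance_sampleMean_le hZ hlaw hind hg hg2 hn
  have hn' : (0 : ℝ) < n := by exact_mod_cast Nat.pos_of_ne_zero hn
  have hc : 0 < η * (n : ℝ) ^ (-(1 / 2) : ℝ) := by positivity
  refine (measure_mono fun ω hω => ?_).trans ((meas_ge_le_variance_div_sq h1 hc).trans
    (ENNReal.ofReal_le_ofReal ?_))
  · simp only [Set.mem_ofPred_eq, h2] at hω ⊢
    rw [Real.enorm_eq_ofReal_abs] at hω
    exact (ENNReal.ofReal_lt_ofReal_iff_of_nonneg hc.le).1 hω |>.le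
  · have e : (η * (n : ℝ) ^ (-(1 / 2) : ℝ)) ^ 2 = η ^ 2 / n := by
      rw [mul_pow, ← Real.rpow_natCast (_ ^ (-(1 / 2) : ℝ)), ← Real.rpow_mul hn'.le]
      norm_num [Real.rpow_neg_one]
      rfl
    rw [e]
    calc _ ≤ (norm2 P g).toReal ^ 2 / n / (η ^ 2 / n) := by gcongr
      _ = _ := by field_simp

lemma isBigOP_empProc (hZ : ∀ i, Measurable (Z i)) (hlaw : ∀ i, Pr.map (Z i) = P)
    (hind : iIndepFun Z Pr) (hg : Measurable g) (hg2 : MemLp g 2 P) :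
    IsBigOP Pr (fun n ω => ‖empProc P (firstN Z n ω) g‖ₑ) (fun n => (n : ℝ) ^ (-(1 / 2) : ℝ)) := by
  intro δ hδ
  have h1 : Tendsto (fun η : ℝ => ENNReal.ofReal ((norm2 P g).toReal ^ 2 / η ^ 2)) atTop (𝓝 0) := by
    rw [← ENNReal.ofReal_zero]
    exact ENNReal.tendsto_ofReal (tendsto_const_nhds.div_atTop (tendsto_pow_atTop two_ne_zero))
  obtain ⟨η, h2, hη⟩ := ((h1.eventually_le_const hδ).and (eventually_gt_atTop 0)).exists
  refine ⟨η, hη, ?_⟩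
  filter_upwards [eventually_ne_atTop 0] with n hn
  exact (chebyshev_empProc hZ hlaw hind hg hg2 hn hη).trans h2

lemma measurable_norm2 [SFinite P] {τ : Type*} [MeasurableSpace τ] {G : τ → Obs d → ℝ}
    (hG : Measurable (Function.uncurry G)) : Measurable fun t => norm2 P (G t) := by
  simp only [norm2, eLpNorm_eq_lintegral_rpow_enorm_toReal (p := 2) (by norm_num) (by norm_num)]
  refine Measurable.pow_const ?_ _
  exact Measurable.lintegral_prod_right'
    (f := fun x : τ × Obs d => ‖G x.1 x.2‖ₑ ^ (2 : ℝ≥0∞).toReal)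
    (hG.enorm.pow_const _)

variable [IsProbabilityMeasure P]

/-- Sample splitting: the centered sample mean of an independently estimated function that is
consistent for zero in `L_2` vanishes faster than `n^{-1/2}`. -/
lemma isLittleOP_empProc_split (hZ : ∀ i, Measurable (Z i)) (hT : ∀ i, Measurable (T i))
    (hlaw : ∀ i, Pr.map (Z i) = P) (hindep : iIndepFun (Sum.elim Z T) Pr)
    {G : (n : ℕ) → (Fin n → Obs d) → Obs d → ℝ} (hG : ∀ n, Measurable (Function.uncurry (G n)))
    (hG0 : IsLittleOP Pr (fun n ω => norm2 P (G n (firstN T n ω))) (fun _ => 1)) :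
    IsLittleOP Pr (fun n ω => ‖empProc P (firstN Z n ω) (G n (firstN T n ω))‖ₑ)
      (fun n => (n : ℝ) ^ (-(1 / 2) : ℝ)) := by
  have hind : iIndepFun Z Pr := hindep.precomp (g := Sum.inl) Sum.inl_injective
  intro η hη
  rw [ENNReal.tendsto_nhds_zero]
  intro δ hδ
  have hδ2 : 0 < δ / 2 := ENNReal.half_pos hδ.ne'
  -- The radius `κ` is chosen so that the Chebyshev bound for any function of norm at most `κ` is
  -- below `δ / 2`.
  have h1 : Tendsto (fun κ : ℝ => ENNReal.ofReal (κ ^ 2 / η ^ 2)) (𝓝[>] 0) (𝓝 0) := by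
    have : Tendsto (fun κ : ℝ => ENNReal.ofReal (κ ^ 2 / η ^ 2)) (𝓝 0)
        (𝓝 (ENNReal.ofReal (0 ^ 2 / η ^ 2))) := by
      refine (ENNReal.continuous_ofReal.comp (by fun_prop)).tendsto 0
    simpa using this.mono_left nhdsWithin_le_nhds
  obtain ⟨κ, h2, hκ⟩ := ((h1.eventually_le_const hδ2).and self_mem_nhdsWithin).exists
  have hκ : 0 < κ := hκ
  filter_upwards [eventually_ne_atTop 0, (hG0 κ hκ).eventually_le_const hδ2] with n hn h3
  set r := ENNReal.ofReal (η * (n : ℝ) ^ (-(1 / 2) : ℝ)) with hr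
  -- Bad pairs of samples: the fitted function is small but its centered mean is large. By
  -- independence the pair has a product law, so `B` is measured by its sections at fixed training
  -- data `t`; each section is empty or handled by Chebyshev.
  let B : Set ((Fin n → Obs d) × (Fin n → Obs d)) :=
    {x | norm2 P (G n x.1) ≤ ENNReal.ofReal κ ∧ r < ‖empProc P x.2 (G n x.1)‖ₑ}
  have hBm : MeasurableSet B := by
    have m1 : Measurable fun x : (Fin n → Obs d) × (Fin n → Obs d) => norm2 P (G n x.1) :=
      (measurable_norm2 (hG n)).comp measurable_fst
    have m2 : Measurable fun t : Fin n → Obs d => ∫ z, G n t z ∂P :=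
      ((hG n).stronglyMeasurable.integral_prod_right (ν := P)).measurable
    have m3 : Measurable fun x : (Fin n → Obs d) × (Fin n → Obs d) => empProc P x.2 (G n x.1) := by
      refine Measurable.sub ?_ (m2.comp measurable_fst)
      refine Measurable.const_mul (Finset.measurable_sum _ fun i _ => ?_) _
      exact (hG n).comp (measurable_fst.prodMk ((measurable_pi_apply i).comp measurable_snd))
    exact (measurableSet_le m1 measurable_const).inter (measurableSet_lt measurable_const m3.enorm)
  have hmZ := measurable_firstN hZ n
  have hmT := measurable_firstN hT n
  have hB : Pr ((fun ω => (firstN T n ω, firstN Z n ω)) ⁻¹' B) ≤ δ / 2 := by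
    rw [← Measure.map_apply (hmT.prodMk hmZ) hBm,
      (indepFun_iff_map_prod_eq_prod_map_map hmT.aemeasurable hmZ.aemeasurable).1
        (indepFun_firstN hZ hT hindep n)]
    have := Measure.isProbabilityMeasure_map (μ := Pr) hmT.aemeasurable
    have := Measure.isProbabilityMeasure_map (μ := Pr) hmZ.aemeasurable
    rw [Measure.prod_apply hBm]
    have hsec : ∀ t, (Pr.map (firstN Z n)) (Prod.mk t ⁻¹' B) ≤ δ / 2 := by
      intro t
      rw [Measure.map_apply hmZ (measurable_prodMk_left hBm)]
      by_cases ht : norm2 P (G n t) ≤ ENNReal.ofReal κ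
      · have hgm : Measurable (G n t) := (hG n).comp measurable_prodMk_left
        have hg2 : MemLp (G n t) 2 P :=
          ⟨hgm.aestronglyMeasurable, ht.trans_lt ENNReal.ofReal_lt_top⟩
        refine (measure_mono fun ω hω => ?_).trans
          ((chebyshev_empProc hZ hlaw hind hgm hg2 hn hη).trans (le_trans ?_ h2))
        · exact hω.2
        · refine ENNReal.ofReal_le_ofReal ?_
          gcongr
          exact ENNReal.toReal_le_of_le_ofReal hκ.le ht
      · have : firstN Z n ⁻¹' (Prod.mk t ⁻¹' B) = ∅ := by
          ext ω; simp [B, ht]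
        simp [this]
    refine (lintegral_mono hsec).trans ?_
    simp
  refine (measure_le_of_ae_imp (ae_of_all _ fun ω hω => ?_)).trans
    ((add_le_add h3 hB).trans (ENNReal.add_halves δ).le)
  by_cases ht : norm2 P (G n (firstN T n ω)) ≤ ENNReal.ofReal κ
  · exact Or.inr ⟨ht, hω⟩
  · left; simpa using ht

end Sampling

end OutcomeModel

namespace OutcomeModel

/-! ### Estimated nuisance functions -/

section Fit

variable {d : ℕ} {P : Measure (Obs d)} {ε C : ℝ} (E : NuisEstimators d) (n : ℕ)
  (S : Finset (Fin d)) (a : Fin 2) (t : Fin n → Obs d)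

lemma measurable_fit_pi : Measurable fun x : (Fin n → Obs d) × Obs d =>
    (E.fit n x.1).pi S a x.2 := by
  have h : Measurable fun x : (Fin n → Obs d) × Obs d => E.pi n S x.1 (covOut S x.2) :=
    (E.measurable_pi n S).comp
      (measurable_fst.prodMk ((measurable_covOut S).comp measurable_snd))
  simp only [NuisEstimators.fit]
  split_ifs
  exacts [h, measurable_const.sub h]

lemma measurable_fit_mu : Measurable fun x : (Fin n → Obs d) × Obs d =>
    (E.fit n x.1).mu S a x.2 :=
  (E.measurable_mu n S a).comp (measurable_fst.prodMk ((measurable_covOut S).comp measurable_snd))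

lemma measurable_fit_reg : Measurable fun x : (Fin n → Obs d) × Obs d =>
    (E.fit n x.1).reg S a x.2 :=
  (E.measurable_reg n S a).comp
    (measurable_fst.prodMk ((measurable_covOut S).comp measurable_snd))

lemma stronglyMeasurable_fit_pi : StronglyMeasurable[sigmaCov S] ((E.fit n t).pi S a) := by
  have h := stronglyMeasurable_comp_covOut (S := S)
    ((E.measurable_pi n S).comp (measurable_prodMk_left (x := t)))
  by_cases ha : a = 1
  · have e : (E.fit n t).pi S a = fun z => E.pi n S t (covOut S z) := by
      ext z; simp [NuisEstimators.fit, ha]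
    rw [e]; exact h
  · have e : (E.fit n t).pi S a = fun z => 1 - E.pi n S t (covOut S z) := by
      ext z; simp [NuisEstimators.fit, ha]
    rw [e]; exact stronglyMeasurable_const.sub h

lemma stronglyMeasurable_fit_mu : StronglyMeasurable[sigmaCov S] ((E.fit n t).mu S a) :=
  stronglyMeasurable_comp_covOut ((E.measurable_mu n S a).comp (measurable_prodMk_left (x := t)))

lemma stronglyMeasurable_fit_reg : StronglyMeasurable[sigmaCov S] ((E.fit n t).reg S a) :=
  stronglyMeasurable_comp_covOut ((E.measurable_reg n S a).comp (measurable_prodMk_left (x := t)))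

lemma measurable_fit_phi : Measurable fun x : (Fin n → Obs d) × Obs d =>
    phi (E.fit n x.1) x.2 := by
  simp_rw [phi_eq_aipw, aipw]
  have h (a : Fin 2) := ((measurable_ind a).comp measurable_snd).mul
    ((measurable_fit_pi E n ∅ a).inv.mul
      ((measurable_outc.comp measurable_snd).sub (measurable_fit_mu E n ∅ a)))
  exact ((measurable_fit_mu E n ∅ 1).add (h 1)).sub ((measurable_fit_mu E n ∅ 0).add (h 0))

lemma measurable_fit_xi : Measurable fun x : (Fin n → Obs d) × Obs d =>
    xi (E.fit n x.1) a x.2 := by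
  have hp := measurable_fit_pi E n ∅ a
  exact (hp.pow_const 2).add ((hp.const_mul 2).mul
    (((measurable_ind a).comp measurable_snd).sub hp))

lemma measurable_fit_lam : Measurable fun x : (Fin n → Obs d) × Obs d =>
    lam (E.fit n x.1) a S x.2 := by
  have hc := (measurable_fit_mu E n S a).sub (measurable_fit_reg E n S a)
  have hi : Measurable fun x : (Fin n → Obs d) × Obs d => ind a x.2 :=
    (measurable_ind a).comp measurable_snd
  have hi' : Measurable fun x : (Fin n → Obs d) × Obs d => ind (1 - a) x.2 :=
    (measurable_ind (1 - a)).comp measurable_snd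
  have hy : Measurable fun x : (Fin n → Obs d) × Obs d => outc x.2 :=
    measurable_outc.comp measurable_snd
  exact (hc.pow_const 2).add ((hc.const_mul 2).mul
    ((((hi.div (measurable_fit_pi E n S a)).mul (hy.sub (measurable_fit_mu E n S a))).sub
      (((hi.div (measurable_fit_pi E n ∅ a)).mul (hy.sub (measurable_fit_mu E n ∅ a))).mul
        ((measurable_fit_pi E n ∅ (1 - a)).div (measurable_fit_pi E n S (1 - a))))).sub
      ((hi'.div (measurable_fit_pi E n S (1 - a))).mul
        ((measurable_fit_mu E n ∅ a).sub (measurable_fit_reg E n S a)))))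

lemma propensityOK_fit
    (h : ∀ᵐ z ∂P, ε ≤ (E.fit n t).pi S 1 z ∧ (E.fit n t).pi S 1 z ≤ 1 - ε) :
    PropensityOK P ε (E.fit n t) S := by
  have hsub : ∀ a z, (E.fit n t).pi S (1 - a) z = 1 - (E.fit n t).pi S a z := by
    intro a z
    obtain rfl | rfl : a = 0 ∨ a = 1 := by omega
    · simp [NuisEstimators.fit]
    · simp [NuisEstimators.fit]
  refine ⟨fun a => stronglyMeasurable_fit_pi E n S a t, fun a => ?_,
    fun a => ae_of_all _ (hsub a)⟩
  filter_upwards [h] with z hz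
  obtain rfl | rfl : a = 0 ∨ a = 1 := by omega
  · have := hsub 1 z
    rw [sub_self] at this
    linarith [hz.2]
  · exact hz.1

lemma outcomeOK_fit (h : ∀ a, MemLp ((E.fit n t).mu ∅ a) 2 P) : OutcomeOK P (E.fit n t) :=
  ⟨fun a => stronglyMeasurable_fit_mu E n ∅ a t, h⟩

end Fit

/-! ### Evaluation at the truth: positivity, boundedness and unbiasedness -/

section

variable {d : ℕ} {P : Measure (Obs d)} {ε C : ℝ} {S : Finset (Fin d)} {a : Fin 2}
  {ν : Nuisances d}

lemma measConf_pos {𝒮 : Finset (Finset (Fin d))} (h : BoundedNonzeroConf P 𝒮) (a : Fin 2) :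
    0 < measConf P 𝒮 a := by
  obtain ⟨hfin, S, hS, hpos⟩ := h a
  have hcard : 0 < (𝒮.card : ℝ) := by exact_mod_cast Finset.card_pos.2 ⟨S, hS⟩
  refine Real.sqrt_pos.2 (mul_pos (by positivity) ?_)
  refine Finset.sum_pos' (fun _ _ => by positivity) ⟨S, hS, pow_pos (ENNReal.toReal_pos ?_ ?_) 2⟩
  · intro h0; simp [h0] at hpos
  · intro h0; have := hfin S hS; simp [h0] at this

lemma norm2_contrast_sub_sq_le (hm : AEStronglyMeasurable (ν.mu S a) P)
    (hr : AEStronglyMeasurable (ν.reg S a) P)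
    (hm0 : AEStronglyMeasurable ((trueNuis P).mu S a) P)
    (hr0 : AEStronglyMeasurable ((trueNuis P).reg S a) P) :
    norm2 P (contrast ν a S - contrast (trueNuis P) a S) ^ 2 ≤ errorProducts P ν a S := by
  have e : contrast ν a S - contrast (trueNuis P) a S
      = (ν.mu S a - (trueNuis P).mu S a) - (ν.reg S a - (trueNuis P).reg S a) := by
    ext z; simp only [contrast, Pi.sub_apply]; ring
  rw [e]
  unfold errorProducts
  rw [add_assoc, add_assoc]
  exact (pow_le_pow_left' (norm2_sub_le (hm.sub hm0) (hr.sub hr0)) 2).trans le_self_add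

/-- Even the third summand vanishes, because the true `reg` is by definition the conditional mean of
the true `μ_a(X)`. -/
lemma errorProducts_true : errorProducts P (trueNuis P) a S = 0 := by
  have h : condMean P (1 - a) S ((trueNuis P).mu ∅ a) - (trueNuis P).reg S a = 0 := sub_self _
  simp [errorProducts, norm2]

/-- The excess of `|c|` over `C` is dominated by `|b - c|` for every `b` bounded by `C`, so its
`L_2` norm is zero. -/
lemma ae_abs_le_of_approx {c : Obs d → ℝ}
    (h : ∀ η : ℝ, 0 < η → ∃ b : Obs d → ℝ, (∀ᵐ z ∂P, |b z| ≤ C) ∧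
      norm2 P (b - c) ^ 2 ≤ ENNReal.ofReal η) (hc : AEStronglyMeasurable c P) :
    ∀ᵐ z ∂P, |c z| ≤ C := by
  let g : Obs d → ℝ := fun z => max (|c z| - C) 0
  have hg : AEStronglyMeasurable g P := by
    have : Continuous fun x : ℝ => max (|x| - C) 0 := by fun_prop
    exact this.comp_aestronglyMeasurable hc
  have h0 : norm2 P g ^ 2 = 0 := by
    refine le_antisymm (ENNReal.le_of_forall_pos_le_add fun η hη _ => ?_) (zero_le)
    obtain ⟨b, hb, hbc⟩ := h η (by exact_mod_cast hη)
    rw [zero_add]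
    refine le_trans (pow_le_pow_left' (eLpNorm_mono_ae ?_) 2) (by simpa [norm2] using hbc)
    filter_upwards [hb] with z hz
    simp only [g, Pi.sub_apply, Real.norm_eq_abs]
    rw [abs_of_nonneg (le_max_right _ _)]
    refine max_le ?_ (abs_nonneg _)
    have := abs_sub_abs_le_abs_sub (c z) (b z)
    rw [abs_sub_comm] at this
    linarith
  have h1 := (eLpNorm_eq_zero_iff hg (by norm_num)).1 (pow_eq_zero_iff (two_ne_zero) |>.1 h0)
  filter_upwards [h1] with z hz
  have := le_max_left (|c z| - C) 0
  simp only [g, Pi.zero_apply] at hz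
  linarith

end

section

variable {d : ℕ} {P : Measure (Obs d)} [IsProbabilityMeasure P] {ε C : ℝ}
  {S : Finset (Fin d)} {a : Fin 2}

lemma integral_phi_true (h : Overlap P ε) (hY : MemLp (outc (d := d)) 2 P) :
    ∫ z, phi (trueNuis P) z ∂P = psi P := by
  have := phi_bias h hY (h.propensityOK ∅) (outcomeOK_true h hY)
  simpa [norm2, sub_eq_zero] using this

lemma integral_xi_true (h : Overlap P ε) (a : Fin 2) :
    ∫ z, xi (trueNuis P) a z ∂P = normPi P a ^ 2 := by
  have := xi_bias h (h.propensityOK ∅) a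
  simpa [norm2, sub_eq_zero] using this

lemma contrastOK_true (h : Overlap P ε) (hY : MemLp (outc (d := d)) 2 P)
    (hC : ∀ᵐ z ∂P, |contrast (trueNuis P) a S z| ≤ C) : ContrastOK P C (trueNuis P) a S :=
  ⟨stronglyMeasurable_condMean _ _ _, stronglyMeasurable_condMean _ _ _, memLp_mu_true h hY S a,
    memLp_reg_true h hY S a, hC⟩

/-- At the truth the error products vanish, so the bias bound becomes an identity. -/
lemma integral_lam_true (h : Overlap P ε) (hY : MemLp (outc (d := d)) 2 P)
    (hc : ContrastOK P C (trueNuis P) a S) :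
    ∫ z, lam (trueNuis P) a S z ∂P = (norm2 P (contrast (trueNuis P) a S)).toReal ^ 2 := by
  have := lam_bias h hY (h.propensityOK ∅) (h.propensityOK S) (outcomeOK_true h hY) hc
  rw [errorProducts_true, mul_zero] at this
  simpa [sub_eq_zero] using this

lemma normPi_pos (h : Overlap P ε) (a : Fin 2) : 0 < normPi P a := by
  have hp := h.propensityOK (P := P) ∅
  have h2 : MemLp ((trueNuis P).pi ∅ a) 2 P := (hp.memLp_top h.1 a).mono_exponent le_top
  have h1 : ε ^ 2 ≤ normPi P a ^ 2 := by
    rw [normPi, norm2_toReal_sq h2]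
    have := integral_mono_ae (integrable_const (ε ^ 2)) h2.integrable_sq (by
      filter_upwards [h.2 ∅ a] with z hz
      exact pow_le_pow_left₀ h.1.le hz 2)
    simpa using this
  exact h.1.trans_le (le_of_sq_le_sq h1 ENNReal.toReal_nonneg)

end

end OutcomeModel

namespace OutcomeModel

/-! ### Asymptotic expansions -/

section Expansion

variable {d : ℕ} {P : Measure (Obs d)} {Ω : Type*} [MeasurableSpace Ω]
  {Pr : Measure Ω} {Z T : ℕ → Ω → Obs d} {S : Finset (Fin d)}
  {a : Fin 2} {ε C : ℝ}

lemma rate_nonneg (n : ℕ) : 0 ≤ (n : ℝ) ^ (-(1 / 2) : ℝ) := by positivity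

lemma tendsto_rate : Tendsto (fun n : ℕ => (n : ℝ) ^ (-(1 / 2) : ℝ)) atTop (𝓝 0) :=
  (tendsto_rpow_neg_atTop (by norm_num)).comp tendsto_natCast_atTop_atTop

/-- Asymptotic linearity of a sample-split one-step estimator with negligible bias. -/
lemma isLittleOP_oneStep [IsProbabilityMeasure P] [IsProbabilityMeasure Pr]
    (hZ : ∀ i, Measurable (Z i)) (hT : ∀ i, Measurable (T i))
    (hlaw : ∀ i, Pr.map (Z i) = P) (hindep : iIndepFun (Sum.elim Z T) Pr)
    {F : (n : ℕ) → (Fin n → Obs d) → Obs d → ℝ} (hF : ∀ n, Measurable (Function.uncurry (F n)))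
    {f : Obs d → ℝ} (hf : Measurable f) (hf2 : MemLp f 2 P)
    (hcons : IsLittleOP Pr (fun n ω => norm2 P (F n (firstN T n ω) - f)) (fun _ => 1))
    (hbias : IsLittleOP Pr (fun n ω => ‖∫ z, F n (firstN T n ω) z ∂P - ∫ z, f z ∂P‖ₑ)
      (fun n => (n : ℝ) ^ (-(1 / 2) : ℝ))) :
    IsLittleOP Pr (fun n ω => ‖(sampleMean (firstN Z n ω) (F n (firstN T n ω)) - ∫ z, f z ∂P)
      - empProc P (firstN Z n ω) f‖ₑ) (fun n => (n : ℝ) ^ (-(1 / 2) : ℝ)) := by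
  have hsplit := isLittleOP_empProc_split hZ hT hlaw hindep (G := fun n t => F n t - f)
    (fun n => (hF n).sub (hf.comp measurable_snd)) hcons
  -- The decomposition splits an integral and so needs `F - f` in `L_2`. Consistency gives norm at
  -- most one outside an event of small probability; the radius one is arbitrary.
  refine (hsplit.enorm_add hbias).of_le_outside fun δ hδ =>
    ⟨1, one_pos, fun n => {ω | ENNReal.ofReal (1 * 1) < norm2 P (F n (firstN T n ω) - f)},
      (hcons 1 one_pos).eventually_le_const hδ, fun n => ae_of_all _ fun ω hω => ?_⟩
  have hFm : Measurable (F n (firstN T n ω)) := (hF n).comp measurable_prodMk_left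
  have hd : MemLp (F n (firstN T n ω) - f) 2 P :=
    ⟨(hFm.sub hf).aestronglyMeasurable, (not_lt.1 hω).trans_lt ENNReal.ofReal_lt_top⟩
  have hadd := empProc_add (firstN Z n ω) (hd.integrable (by norm_num))
    (hf2.integrable (by norm_num))
  simp only [Pi.sub_apply, sub_add_cancel] at hadd
  have e : sampleMean (firstN Z n ω) (F n (firstN T n ω)) - ∫ z, f z ∂P
        - empProc P (firstN Z n ω) f
      = empProc P (firstN Z n ω) (F n (firstN T n ω) - f)
        + (∫ z, F n (firstN T n ω) z ∂P - ∫ z, f z ∂P) := by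
    have h2 : empProc P (firstN Z n ω) (F n (firstN T n ω))
        = sampleMean (firstN Z n ω) (F n (firstN T n ω)) - ∫ z, F n (firstN T n ω) z ∂P := rfl
    have h3 : empProc P (firstN Z n ω) (fun z => F n (firstN T n ω) z)
      = empProc P (firstN Z n ω) (F n (firstN T n ω)) := rfl
    rw [h3] at hadd
    linarith
  rw [e]; simp

lemma isLittleOP_of_sq {X : ℕ → Ω → ℝ≥0∞}
    (h : IsLittleOP Pr X (fun n => (n : ℝ) ^ (-(1 / 4) : ℝ))) :
    IsLittleOP Pr (fun n ω => X n ω ^ 2) (fun n => (n : ℝ) ^ (-(1 / 2) : ℝ)) := by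
  intro ε hε
  refine (h (√ε) (Real.sqrt_pos.2 hε)).congr fun n => ?_
  congr 1
  ext ω
  have e : ENNReal.ofReal (ε * (n : ℝ) ^ (-(1 / 2) : ℝ))
      = ENNReal.ofReal (√ε * (n : ℝ) ^ (-(1 / 4) : ℝ)) ^ 2 := by
    rw [← ENNReal.ofReal_pow (by positivity), mul_pow, Real.sq_sqrt hε.le,
      ← Real.rpow_natCast (_ ^ (-(1 / 4) : ℝ)), ← Real.rpow_mul (by positivity)]
    norm_num
  simp only [Set.mem_ofPred_eq, e]
  exact (ENNReal.pow_right_strictMono two_ne_zero).lt_iff_lt.symm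

/-- A bounded-in-probability contrast estimate whose nuisance errors vanish has a bounded limit. -/
lemma exists_bound_contrast_true [IsProbabilityMeasure Pr] (E : NuisEstimators d)
    {ν : ℕ → Ω → Nuisances d}
    (hν : ∀ n ω, ν n ω = E.fit n (firstN T n ω))
    (hbdd : IsBoundedP Pr (fun n ω => eLpNorm (contrast (ν n ω) a S) ∞ P))
    (herr : IsLittleOP Pr (fun n ω => errorProducts P (ν n ω) a S)
      (fun n => (n : ℝ) ^ (-(1 / 2) : ℝ))) :
    ∃ C, ∀ᵐ z ∂P, |contrast (trueNuis P) a S z| ≤ C := by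
  -- The two bad events get probabilities at most `1/2` and `1/4`, whose sum is below one, so some
  -- outcome `ω` avoids both. The constant `C` is fixed before the accuracy `η`.
  obtain ⟨C, hC⟩ := hbdd 2⁻¹ (by simp)
  have hm0 := (stronglyMeasurable_condMean (P := P) a S outc).of_sigmaCov.aestronglyMeasurable
    (μ := P)
  have hr0 := (stronglyMeasurable_condMean (P := P) (1 - a) S
    (condMean P a ∅ outc)).of_sigmaCov.aestronglyMeasurable (μ := P)
  refine ⟨C, ae_abs_le_of_approx (fun η hη => ?_) (hm0.sub hr0)⟩
  obtain ⟨n, h1, h2, hn⟩ := (hC.and (((herr η hη).eventually_le_const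
    (u := 4⁻¹) (by simp)).and (eventually_ge_atTop 1))).exists
  have hex : ∃ ω, ω ∉ {ω | (C : ℝ≥0∞) < eLpNorm (contrast (ν n ω) a S) ∞ P} ∪
      {ω | ENNReal.ofReal (η * (n : ℝ) ^ (-(1 / 2) : ℝ)) < errorProducts P (ν n ω) a S} := by
    by_contra! hall
    have h3 : (1 : ℝ≥0∞) ≤ 2⁻¹ + 4⁻¹ := by
      rw [← measure_univ (μ := Pr)]
      exact (measure_mono fun ω _ => hall ω).trans
        ((measure_union_le _ _).trans (add_le_add h1 h2))
    have h4 := ENNReal.toReal_mono (by simp) h3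
    rw [ENNReal.toReal_add (by simp) (by simp)] at h4
    norm_num at h4
  obtain ⟨ω, hω⟩ := hex
  simp only [Set.mem_union, Set.mem_ofPred_eq, not_or, not_lt] at hω
  refine ⟨contrast (ν n ω) a S, ?_, ?_⟩
  · filter_upwards [ae_le_eLpNormEssSup (f := contrast (ν n ω) a S) (μ := P)] with z hz
    have := hz.trans (by simpa using hω.1)
    rw [← Real.norm_eq_abs, ← toReal_enorm]
    simpa using ENNReal.toReal_mono (by simp) this
  · have hm : AEStronglyMeasurable ((ν n ω).mu S a) P := by
      rw [hν]; exact (stronglyMeasurable_fit_mu E n S a _).of_sigmaCov.aestronglyMeasurable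
    have hr : AEStronglyMeasurable ((ν n ω).reg S a) P := by
      rw [hν]; exact (stronglyMeasurable_fit_reg E n S a _).of_sigmaCov.aestronglyMeasurable
    refine (norm2_contrast_sub_sq_le hm hr hm0 hr0).trans (hω.2.trans
      (ENNReal.ofReal_le_ofReal ?_))
    have : (n : ℝ) ^ (-(1 / 2) : ℝ) ≤ 1 :=
      Real.rpow_le_one_of_one_le_of_nonpos (by exact_mod_cast hn) (by norm_num)
    nlinarith

/-- The constant in `lam_bias` grows with the bound on the estimated contrast, which is controlled
only in probability; domination outside events of small probability is therefore enough. -/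
lemma isLittleOP_lam_bias [IsProbabilityMeasure P] (E : NuisEstimators d) {ν : ℕ → Ω → Nuisances d}
    (hν : ∀ n ω, ν n ω = E.fit n (firstN T n ω)) (h : Overlap P ε)
    (hY : MemLp (outc (d := d)) 2 P)
    (hp : ∀ n, ∀ᵐ ω ∂Pr, PropensityOK P ε (ν n ω) ∅)
    (hpS : ∀ n, ∀ᵐ ω ∂Pr, PropensityOK P ε (ν n ω) S)
    (hm : ∀ n, ∀ᵐ ω ∂Pr, OutcomeOK P (ν n ω))
    (hbdd : IsBoundedP Pr (fun n ω => eLpNorm (contrast (ν n ω) a S) ∞ P))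
    (herr : IsLittleOP Pr (fun n ω => errorProducts P (ν n ω) a S)
      (fun n => (n : ℝ) ^ (-(1 / 2) : ℝ))) :
    IsLittleOP Pr (fun n ω => ‖∫ z, lam (ν n ω) a S z ∂P
      - (norm2 P (contrast (trueNuis P) a S)).toReal ^ 2‖ₑ)
      (fun n => (n : ℝ) ^ (-(1 / 2) : ℝ)) := by
  refine herr.of_le_outside fun δ hδ => ?_
  have hδ2 : 0 < δ / 2 := ENNReal.half_pos hδ.ne'
  obtain ⟨C, hC⟩ := hbdd (δ / 2) hδ2
  have hε := h.1
  refine ⟨1 + 2 * C * (ε⁻¹ * ε⁻¹ * ε⁻¹), by positivity, fun n =>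
    {ω | (C : ℝ≥0∞) < eLpNorm (contrast (ν n ω) a S) ∞ P} ∪
      {ω | ENNReal.ofReal (1 * (n : ℝ) ^ (-(1 / 2) : ℝ)) < errorProducts P (ν n ω) a S}, ?_, ?_⟩
  · filter_upwards [hC, (herr 1 one_pos).eventually_le_const hδ2] with n h1 h2
    exact (measure_union_le _ _).trans ((add_le_add h1 h2).trans (ENNReal.add_halves δ).le)
  intro n
  filter_upwards [hp n, hpS n, hm n] with ω h1 h2 h3 hω
  simp only [Set.mem_union, Set.mem_ofPred_eq, not_or, not_lt] at hω
  have hfin : errorProducts P (ν n ω) a S < ∞ := hω.2.trans_lt ENNReal.ofReal_lt_top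
  -- Square integrability of the fitted regressions on `X_{-S}` is not assumed: the first summand of
  -- the error products is finite here, so they differ from square-integrable truths by `L_2`
  -- functions.
  have hfin2 : norm2 P ((ν n ω).mu S a - (trueNuis P).mu S a)
      + norm2 P ((ν n ω).reg S a - (trueNuis P).reg S a) < ∞ := by
    have : (norm2 P ((ν n ω).mu S a - (trueNuis P).mu S a)
      + norm2 P ((ν n ω).reg S a - (trueNuis P).reg S a)) ^ 2 < ∞ := by
      refine lt_of_le_of_lt ?_ hfin
      unfold errorProducts
      rw [add_assoc, add_assoc]
      exact le_self_add
    exact (ENNReal.pow_lt_top_iff.1 this).resolve_right two_ne_zero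
  have mm : StronglyMeasurable[sigmaCov S] ((ν n ω).mu S a) := by
    rw [hν]; exact stronglyMeasurable_fit_mu E n S a _
  have mr : StronglyMeasurable[sigmaCov S] ((ν n ω).reg S a) := by
    rw [hν]; exact stronglyMeasurable_fit_reg E n S a _
  have mm0 := memLp_mu_true h hY S a
  have mr0 := memLp_reg_true h hY S a
  have lm : MemLp ((ν n ω).mu S a - (trueNuis P).mu S a) 2 P :=
    ⟨mm.of_sigmaCov.aestronglyMeasurable.sub mm0.1, le_self_add.trans_lt hfin2⟩
  have lr : MemLp ((ν n ω).reg S a - (trueNuis P).reg S a) 2 P :=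
    ⟨mr.of_sigmaCov.aestronglyMeasurable.sub mr0.1, le_add_self.trans_lt hfin2⟩
  refine lam_bias h hY h1 h2 h3 ⟨mm, mr, ?_, ?_, ?_⟩
  · simpa using lm.add mm0
  · simpa using lr.add mr0
  · filter_upwards [ae_le_eLpNormEssSup (f := contrast (ν n ω) a S) (μ := P)] with z hz
    have := hz.trans (by simpa using hω.1)
    rw [← Real.norm_eq_abs, ← toReal_enorm]
    simpa using ENNReal.toReal_mono (by simp) this

/-- The delta method for the product of square roots. -/
lemma isLittleOP_sqrt_mul_sqrt {U W DU DW : ℕ → Ω → ℝ} {p q : ℝ} (hp : 0 < p) (hq : 0 < q)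
    {r : ℕ → ℝ} (hr0 : ∀ n, 0 ≤ r n) (hr : Tendsto r atTop (𝓝 0))
    (hDU : IsBigOP Pr (fun n ω => ‖DU n ω‖ₑ) r) (hDW : IsBigOP Pr (fun n ω => ‖DW n ω‖ₑ) r)
    (hU : IsLittleOP Pr (fun n ω => ‖U n ω - p ^ 2 - DU n ω‖ₑ) r)
    (hW : IsLittleOP Pr (fun n ω => ‖W n ω - q ^ 2 - DW n ω‖ₑ) r) :
    IsLittleOP Pr (fun n ω => ‖√(U n ω) * √(W n ω) - p * q
      - (q / (2 * p) * DU n ω + p / (2 * q) * DW n ω)‖ₑ) r := by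
  have sp : √(p ^ 2) = p := Real.sqrt_sq hp.le
  have sq' : √(q ^ 2) = q := Real.sqrt_sq hq.le
  -- Differentiability uses that both coordinates are non-zero. At this point the partial
  -- derivatives are `q / (2 * p)` and `p / (2 * q)`.
  have hd : HasFDerivAt (fun x : ℝ × ℝ => √x.1 * √x.2) _ (p ^ 2, q ^ 2) :=
    ((hasFDerivAt_fst (𝕜 := ℝ) (p := ((p ^ 2, q ^ 2) : ℝ × ℝ))).sqrt (by positivity)).mul
      (hasFDerivAt_snd.sqrt (by positivity))
  have hbU : IsBigOP Pr (fun n ω => ‖U n ω - p ^ 2‖ₑ) r :=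
    (hU.isBigOP.add hDU).mono fun n ω =>
      (congrArg enorm (sub_add_cancel (U n ω - p ^ 2) (DU n ω)).symm).le.trans (enorm_add_le _ _)
  have hbW : IsBigOP Pr (fun n ω => ‖W n ω - q ^ 2‖ₑ) r :=
    (hW.isBigOP.add hDW).mono fun n ω =>
      (congrArg enorm (sub_add_cancel (W n ω - q ^ 2) (DW n ω)).symm).le.trans (enorm_add_le _ _)
  have hb : IsBigOP Pr (fun n ω => ‖((U n ω, W n ω) : ℝ × ℝ) - (p ^ 2, q ^ 2)‖ₑ) r :=
    (hbU.add hbW).mono fun n ω => by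
      simp only [← ofReal_norm]
      rw [← ENNReal.ofReal_add (norm_nonneg _) (norm_nonneg _)]
      refine ENNReal.ofReal_le_ofReal ?_
      rw [Prod.norm_def]
      exact max_le_add_of_nonneg (norm_nonneg _) (norm_nonneg _)
  have hmain := ((hb.delta hd hr0 hr).enorm_add (hU.enorm_const_mul (q / (2 * p)))).enorm_add
    (hW.enorm_const_mul (p / (2 * q)))
  refine hmain.mono fun n ω => le_of_eq ?_
  congr 1
  simp [sp, sq']
  field_simp
  ring

end Expansion

end OutcomeModel

namespace OutcomeModel

/-! ### The true influence functions: measurability and linear combination -/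

section

variable {d : ℕ} {P : Measure (Obs d)}

lemma measurable_phi_true : Measurable (phi (trueNuis P)) := by
  have h : phi (trueNuis P) = fun z => aipw (trueNuis P) 1 z - aipw (trueNuis P) 0 z :=
    funext (phi_eq_aipw _)
  rw [h]
  have hm (a : Fin 2) := (stronglyMeasurable_condMean (P := P) a ∅ outc).of_sigmaCov.measurable
  have hp (a : Fin 2) := (stronglyMeasurable_pi (P := P) ∅ a).of_sigmaCov.measurable
  have hw (a : Fin 2) : Measurable (aipw (trueNuis P) a) :=
    (hm a).add ((measurable_ind a).mul ((hp a).inv.mul (measurable_outc.sub (hm a))))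
  exact (hw 1).sub (hw 0)

lemma measurable_xi_true (a : Fin 2) : Measurable (xi (trueNuis P) a) := by
  have hp := (stronglyMeasurable_pi (P := P) ∅ a).of_sigmaCov.measurable
  exact (hp.pow_const 2).add ((hp.const_mul 2).mul ((measurable_ind a).sub hp))

lemma measurable_lam_true (a : Fin 2) (S : Finset (Fin d)) :
    Measurable (lam (trueNuis P) a S) := by
  have hm (S) := (stronglyMeasurable_condMean (P := P) a S outc).of_sigmaCov.measurable
  have hr := (stronglyMeasurable_condMean (P := P) (1 - a) S
    (condMean P a ∅ outc)).of_sigmaCov.measurable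
  have hp (S) (a : Fin 2) := (stronglyMeasurable_pi (P := P) S a).of_sigmaCov.measurable
  have hc := (hm S).sub hr
  have hi := measurable_ind (d := d)
  exact (hc.pow_const 2).add ((hc.const_mul 2).mul
    (((((hi a).div (hp S a)).mul (measurable_outc.sub (hm S))).sub
      ((((hi a).div (hp ∅ a)).mul (measurable_outc.sub (hm ∅))).mul
        ((hp ∅ (1 - a)).div (hp S (1 - a))))).sub
      (((hi (1 - a)).div (hp S (1 - a))).mul ((hm ∅).sub hr))))

/-- The influence function is linear in `φ`, `ξ` and `λ`. -/
lemma empProc_inflFun {𝒮 : Finset (Finset (Fin d))} (Γ : ℝ) {n : ℕ} (s : Fin n → Obs d)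
    (hphi : Integrable (phi (trueNuis P)) P) (hxi : ∀ a, Integrable (xi (trueNuis P) a) P)
    (hlam : ∀ a, ∀ S ∈ 𝒮, Integrable (lam (trueNuis P) a S) P) :
    empProc P s (inflFun P 𝒮 Γ) = empProc P s (phi (trueNuis P)) + Γ * ∑ a : Fin 2,
      (measConf P 𝒮 a / (2 * normPi P (1 - a)) * empProc P s (xi (trueNuis P) (1 - a))
        + normPi P (1 - a) / (2 * measConf P 𝒮 a) * ((1 / (𝒮.card : ℝ)) *
          ∑ S ∈ 𝒮, empProc P s (lam (trueNuis P) a S))) := by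
  have e : inflFun P 𝒮 Γ = fun z => phi (trueNuis P) z + Γ * ∑ a : Fin 2,
      (measConf P 𝒮 a / (2 * normPi P (1 - a)) * xi (trueNuis P) (1 - a) z
        + normPi P (1 - a) / (2 * measConf P 𝒮 a) * ((1 / (𝒮.card : ℝ)) *
          ∑ S ∈ 𝒮, lam (trueNuis P) a S z)) := by
    ext z
    unfold inflFun
    congr 2
    refine Finset.sum_congr rfl fun a _ => ?_
    rw [← Finset.sum_div]
    ring
  have i1 (a : Fin 2) := (hxi (1 - a)).const_mul (measConf P 𝒮 a / (2 * normPi P (1 - a)))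
  have i2 (a : Fin 2) := ((integrable_finsetSum 𝒮 (hlam a)).const_mul (1 / (𝒮.card : ℝ))).const_mul
    (normPi P (1 - a) / (2 * measConf P 𝒮 a))
  have i12 (a : Fin 2) : Integrable (fun z =>
      measConf P 𝒮 a / (2 * normPi P (1 - a)) * xi (trueNuis P) (1 - a) z
        + normPi P (1 - a) / (2 * measConf P 𝒮 a) * ((1 / (𝒮.card : ℝ)) *
          ∑ S ∈ 𝒮, lam (trueNuis P) a S z)) P := (i1 a).add (i2 a)
  rw [e, empProc_add s hphi ((integrable_finsetSum _ fun a _ => i12 a).const_mul Γ),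
    empProc_const_mul, empProc_sum s _ fun a _ => i12 a]
  congr 2
  refine Finset.sum_congr rfl fun a _ => ?_
  rw [empProc_add s (i1 a) (i2 a), empProc_const_mul, empProc_const_mul, empProc_const_mul,
    empProc_sum s _ (hlam a)]

end

end OutcomeModel

/-! ### Assembly of the expansion -/

open OutcomeModel
theorem mainTheorem6 {d : ℕ} (P : Measure (Obs d)) [IsProbabilityMeasure P]
    (𝒮 : Finset (Finset (Fin d))) (Γ : ℝ) (hΓ : 0 < Γ)
    -- the estimation sample `Z` and the training sample `T`: all observations are i.i.d. from `P`
    {Ω : Type*} [MeasurableSpace Ω] (Pr : Measure Ω) [IsProbabilityMeasure Pr]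
    (Z T : ℕ → Ω → Obs d)
    (hZ : ∀ i, Measurable (Z i)) (hT : ∀ i, Measurable (T i))
    (hZlaw : ∀ i, Pr.map (Z i) = P) (hTlaw : ∀ i, Pr.map (T i) = P)
    (hindep : iIndepFun (Sum.elim Z T) Pr)
    -- finite second moment of the outcome, positivity, bounded and non-zero measured confounding
    (hY : MemLp (outc (d := d)) 2 P)
    (hpos : Positivity P) (hconf : BoundedNonzeroConf P 𝒮)
    -- the nuisance estimators; `ν n ω` are the estimates from the first `n` training observations
    (E : NuisEstimators d) (ν : ℕ → Ω → Nuisances d)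
    (hν : ∀ n ω, ν n ω = E.fit n (firstN T n ω))
    (hmu : ∀ n a, ∀ᵐ ω ∂Pr, MemLp ((ν n ω).mu ∅ a) 2 P)
    (hbdd : ∀ a, ∀ S ∈ 𝒮,
      IsBoundedP Pr (fun n ω => eLpNorm (contrast (ν n ω) a S) ∞ P))
    -- estimated propensity scores are bounded away from zero and one
    (h1 : ∃ ε : ℝ, 0 < ε ∧ ∀ S ∈ insert ∅ 𝒮, ∀ n, ∀ᵐ ω ∂Pr, ∀ᵐ z ∂P,
      ε ≤ (ν n ω).pi S 1 z ∧ (ν n ω).pi S 1 z ≤ 1 - ε)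
    -- consistency of the estimated influence functions
    (h2 : IsLittleOP Pr (fun n ω => norm2 P (phi (ν n ω) - phi (trueNuis P))) (fun _ => 1))
    (h3 : ∀ a, IsLittleOP Pr (fun n ω => norm2 P (xi (ν n ω) a - xi (trueNuis P) a))
      (fun _ => 1))
    (h4 : ∀ a, ∀ S ∈ 𝒮,
      IsLittleOP Pr (fun n ω => norm2 P (lam (ν n ω) a S - lam (trueNuis P) a S)) (fun _ => 1))
    -- rates for the nuisance estimators
    (h5 : ∀ a, IsLittleOP Pr
      (fun n ω => norm2 P ((ν n ω).pi ∅ 1 - (trueNuis P).pi ∅ 1) *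
        norm2 P ((ν n ω).mu ∅ a - (trueNuis P).mu ∅ a))
      (fun n => (n : ℝ) ^ (-(1 / 2) : ℝ)))
    (h6 : IsLittleOP Pr (fun n ω => norm2 P ((ν n ω).pi ∅ 1 - (trueNuis P).pi ∅ 1))
      (fun n => (n : ℝ) ^ (-(1 / 4) : ℝ)))
    (h7 : ∀ a, ∀ S ∈ 𝒮, IsLittleOP Pr (fun n ω => errorProducts P (ν n ω) a S)
      (fun n => (n : ℝ) ^ (-(1 / 2) : ℝ))) :
    IsLittleOP Pr
      (fun n ω => ‖(upperEst E 𝒮 Γ (firstN T n ω) (firstN Z n ω) - upperBound P 𝒮 Γ)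
        - (sampleMean (firstN Z n ω) (inflFun P 𝒮 Γ) - ∫ z, inflFun P 𝒮 Γ z ∂P)‖ₑ)
      (fun n => (n : ℝ) ^ (-(1 / 2) : ℝ)) := by
  have hindZ : iIndepFun Z Pr := hindep.precomp (g := Sum.inl) Sum.inl_injective
  obtain ⟨ε₀, h0⟩ := hpos.overlap
  obtain ⟨ε₁, hε₁, h1⟩ := h1
  -- The bias bounds use one `ε` for true and estimated scores alike.
  have hO : Overlap P (min ε₀ ε₁) := h0.mono (lt_min h0.1 hε₁) (min_le_left _ _)
  set ε := min ε₀ ε₁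
  have hε := hO.1
  have hprop : ∀ S ∈ insert ∅ 𝒮, ∀ n, ∀ᵐ ω ∂Pr, PropensityOK P ε (ν n ω) S := by
    intro S hS n
    filter_upwards [h1 S hS n] with ω hω
    rw [hν] at hω ⊢
    refine propensityOK_fit E n S _ (hω.mono fun z hz => ?_)
    have : ε ≤ ε₁ := min_le_right _ _
    exact ⟨this.trans hz.1, by linarith [hz.2]⟩
  have hp0 := hprop ∅ (Finset.mem_insert_self _ _)
  have hpS := fun S (hS : S ∈ 𝒮) => hprop S (Finset.mem_insert_of_mem hS)
  have hout : ∀ n, ∀ᵐ ω ∂Pr, OutcomeOK P (ν n ω) := by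
    intro n
    filter_upwards [ae_all_iff.2 (hmu n)] with ω hω
    rw [hν] at hω ⊢
    exact outcomeOK_fit E n _ hω
  have htrue := outcomeOK_true hO hY
  have hphi2 : MemLp (phi (trueNuis P)) 2 P := memLp_phi hε hY (hO.propensityOK ∅) htrue
  have hxi2 (a : Fin 2) : MemLp (xi (trueNuis P) a) 2 P := memLp_xi hε (hO.propensityOK ∅) a
  -- `λ` multiplies the contrast by residuals that are only square-integrable, so a bounded true
  -- contrast is what puts it in `L_2`.
  have hcon : ∀ a, ∀ S ∈ 𝒮, ∃ C, ContrastOK P C (trueNuis P) a S := fun a S hS => by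
    obtain ⟨C, hC⟩ := exists_bound_contrast_true E hν (hbdd a S hS) (h7 a S hS)
    exact ⟨C, contrastOK_true hO hY hC⟩
  have hlam2 : ∀ a, ∀ S ∈ 𝒮, MemLp (lam (trueNuis P) a S) 2 P := fun a S hS => by
    obtain ⟨C, hC⟩ := hcon a S hS
    exact memLp_lam hε hY (hO.propensityOK ∅) (hO.propensityOK S) htrue hC
  have hlamint : ∀ a, ∀ S ∈ 𝒮, ∫ z, lam (trueNuis P) a S z ∂P
      = (norm2 P (contrast (trueNuis P) a S)).toReal ^ 2 := fun a S hS => by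
    obtain ⟨C, hC⟩ := hcon a S hS
    exact integral_lam_true hO hY hC
  -- one-step expansions of the three kinds of estimators
  have Rphi : IsLittleOP Pr (fun n ω => ‖(sampleMean (firstN Z n ω) (phi (ν n ω)) - psi P)
      - empProc P (firstN Z n ω) (phi (trueNuis P))‖ₑ) (fun n => (n : ℝ) ^ (-(1 / 2) : ℝ)) := by
    simp only [hν] at h2 h5 hp0 hout ⊢
    rw [← integral_phi_true hO hY]
    refine isLittleOP_oneStep hZ hT hZlaw hindep (F := fun n t => phi (E.fit n t))
      (measurable_fit_phi E) measurable_phi_true hphi2 h2 ?_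
    refine (IsLittleOP.sum (s := Finset.univ) fun a _ => h5 a).of_ae_le (K := ε⁻¹) fun n => ?_
    filter_upwards [hp0 n, hout n] with ω w1 w2
    rw [integral_phi_true hO hY]
    exact phi_bias hO hY w1 w2
  have Rxi (a : Fin 2) : IsLittleOP Pr
      (fun n ω => ‖sampleMean (firstN Z n ω) (xi (ν n ω) a) - normPi P a ^ 2
      - empProc P (firstN Z n ω) (xi (trueNuis P) a)‖ₑ) (fun n => (n : ℝ) ^ (-(1 / 2) : ℝ)) := by
    simp only [hν] at h3 h6 hp0 ⊢
    rw [← integral_xi_true hO]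
    refine isLittleOP_oneStep hZ hT hZlaw hindep (F := fun n t => xi (E.fit n t) a)
      (fun n => measurable_fit_xi E n a) (measurable_xi_true a) (hxi2 a) (h3 a) ?_
    refine (isLittleOP_of_sq h6).of_ae_le (K := 1) fun n => ?_
    filter_upwards [hp0 n] with ω w1
    rw [integral_xi_true hO, ENNReal.ofReal_one, one_mul]
    exact xi_bias hO w1 a
  have Rlam : ∀ a, ∀ S ∈ 𝒮, IsLittleOP Pr
      (fun n ω => ‖sampleMean (firstN Z n ω) (lam (ν n ω) a S)
        - (norm2 P (contrast (trueNuis P) a S)).toReal ^ 2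
        - empProc P (firstN Z n ω) (lam (trueNuis P) a S)‖ₑ)
      (fun n => (n : ℝ) ^ (-(1 / 2) : ℝ)) := by
    intro a S hS
    have hb := isLittleOP_lam_bias E hν hO hY hp0 (hpS S hS) hout (hbdd a S hS) (h7 a S hS)
    simp only [hν] at h4 hb ⊢
    rw [← hlamint a S hS] at hb ⊢
    exact isLittleOP_oneStep hZ hT hZlaw hindep (F := fun n t => lam (E.fit n t) a S)
      (fun n => measurable_fit_lam E n S a) (measurable_lam_true a S) (hlam2 a S hS)
      (h4 a S hS) hb
  -- the averages over `𝒮`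
  have Ravg (a : Fin 2) : IsLittleOP Pr
      (fun n ω => ‖(1 / (𝒮.card : ℝ)) * ∑ S ∈ 𝒮, sampleMean (firstN Z n ω) (lam (ν n ω) a S)
        - measConf P 𝒮 a ^ 2
        - (1 / (𝒮.card : ℝ)) * ∑ S ∈ 𝒮, empProc P (firstN Z n ω) (lam (trueNuis P) a S)‖ₑ)
      (fun n => (n : ℝ) ^ (-(1 / 2) : ℝ)) := by
    have hM : measConf P 𝒮 a ^ 2 = (1 / (𝒮.card : ℝ)) *
        ∑ S ∈ 𝒮, (norm2 P (contrast (trueNuis P) a S)).toReal ^ 2 :=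
      Real.sq_sqrt (mul_nonneg (by positivity) (Finset.sum_nonneg fun _ _ => by positivity))
    refine ((IsLittleOP.enorm_sum (Rlam a)).enorm_const_mul (1 / (𝒮.card : ℝ))).mono
      fun n ω => le_of_eq ?_
    rw [hM, Finset.sum_sub_distrib, Finset.sum_sub_distrib]
    congr 1
    ring
  have Bavg (a : Fin 2) : IsBigOP Pr
      (fun n ω => ‖(1 / (𝒮.card : ℝ)) *
        ∑ S ∈ 𝒮, empProc P (firstN Z n ω) (lam (trueNuis P) a S)‖ₑ)
      (fun n => (n : ℝ) ^ (-(1 / 2) : ℝ)) := by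
    have hm : Measurable fun z => (1 / (𝒮.card : ℝ)) * ∑ S ∈ 𝒮, lam (trueNuis P) a S z :=
      (Finset.measurable_sum _ fun S _ => measurable_lam_true a S).const_mul _
    -- The average over `𝒮` is treated as a single square-integrable function, so one application of
    -- Chebyshev gives the root-`n` bound.
    have h2 : MemLp (fun z => (1 / (𝒮.card : ℝ)) * ∑ S ∈ 𝒮, lam (trueNuis P) a S z) 2 P :=
      (memLp_finsetSum _ fun S hS => hlam2 a S hS).const_mul _
    refine (isBigOP_empProc hZ hZlaw hindZ hm h2).mono fun n ω => le_of_eq ?_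
    rw [empProc_const_mul, empProc_sum _ _ fun S hS => (hlam2 a S hS).integrable (by norm_num)]
  have Q (a : Fin 2) := isLittleOP_sqrt_mul_sqrt (normPi_pos hO (1 - a)) (measConf_pos hconf a)
    rate_nonneg tendsto_rate
    (isBigOP_empProc hZ hZlaw hindZ (measurable_xi_true (1 - a)) (hxi2 (1 - a))) (Bavg a)
    (Rxi (1 - a)) (Ravg a)
  refine (Rphi.enorm_add ((IsLittleOP.enorm_sum (s := Finset.univ) fun a _ =>
    Q a).enorm_const_mul Γ)).mono fun n ω => le_of_eq ?_
  have hE := empProc_inflFun Γ (firstN Z n ω) (hphi2.integrable (by norm_num))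
    (fun a => (hxi2 a).integrable (by norm_num))
    (fun a S hS => (hlam2 a S hS).integrable (by norm_num))
  rw [empProc] at hE
  rw [hE]
  congr 1
  simp only [upperEst, upperBound, ← hν, Finset.sum_sub_distrib]
  ring
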